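/- Let $d\ge 2$, let $\mathbb T^d=\mathbb R^d/2\pi\mathbb Z^d$ and let $\mathfrak p:\mathbb R^d\to\mathbb T^d$ be the projection. Let each of $K_1,K_2\subset\mathbb R^d$ be either a single point or a compact convex set with nonempty interior whose boundary is a smooth hypersurface with all principal curvatures positive. For each $j$ choose an orientation, i.e. either the outward or the inward unit normal to $K_j$ along $\partial K_j$ (if $K_j$ is a point, every unit vector is regarded as a normal, for both choices). Let $\mathcal P_{K_1,K_2}$ be the set of orthogeodesics, i.e. of geodesic arcs $\gamma:[0,\ell(\gamma)]\to\mathbb T^d$, $\ell(\gamma)>0$, parametrized by arc length, for which there are $x_1\in\partial K_1$ and $x_2\in\partial K_2$ with $\gamma(0)=\mathfrak p(x_1)$, $\gamma(\ell(\gamma))=\mathfrak p(x_2)$, such that $\gamma'(0)$ and $\gamma'(\ell(\gamma))$ are the chosen unit normals to $K_1$ at $x_1$ and to $K_2$ at $x_2$. Let $\beta$ be a smooth closed real-valued one-form on $\mathbb T^d$, written as $\beta=\sum_{i=1}^d\beta_i\,dx_i+df$ with $\beta_i\in\mathbb R$ and $f\in C^\infty(\mathbb T^d;\mathbb R)$;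 its cohomology class $[\beta]$ belongs to $H^1(\mathbb T^d,\mathbb Z)$ if and only if $\beta_i\in\mathbb Z$ for all $i$. There is $T_0>0$ such that $\{\gamma\in\mathcal P_{K_1,K_2}: T_0<\ell(\gamma)\le T\}$ is finite for every $T>0$. For every such $T_0$, the generalized Epstein zeta function $$\zeta_\beta(K_1,K_2,s)=\sum_{\gamma\in\mathcal P_{K_1,K_2}:\ \ell(\gamma)>T_0}\frac{e^{i\int_\gamma\beta}}{\ell(\gamma)^{s}}$$ converges absolutely for $\operatorname{Re}(s)>d$, and the following holds. 1. If $[\beta]\in H^1(\mathbb T^d,\mathbb Z)$, then $\zeta_\beta(K_1,K_2,s)$ extends from $\{\operatorname{Re}(s)>d\}$ to a meromorphic function on $\mathbb C$ which is holomorphic outside $\{1,\dots,d\}$ and has at most simple poles at $s=1,\dots,d$. 2. If $[\beta]\notin H^1(\mathbb T^d,\mathbb Z)$, then $\zeta_\beta(K_1,K_2,s)$ extends from $\{\operatorname{Re}(s)>d\}$ to an entire function. -/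

import Mathlib

open scoped ContDiff

/-- Euclidean space `ℝ^d`. -/
abbrev Euc (d : ℕ) : Type := EuclideanSpace ℝ (Fin d)

/-- The flat torus `𝕋^d = ℝ^d / 2πℤ^d`, as an additive group. -/
abbrev FlatTorus (d : ℕ) : Type := Fin d → AddCircle (2 * Real.pi)

/-- The canonical projection `ℝ^d → 𝕋^d`. -/
noncomputable def torusProj {d : ℕ} (v : Euc d) : FlatTorus d :=
  fun i => ((v i : ℝ) : AddCircle (2 * Real.pi))

/-! ### Strictly convex compact sets with smooth boundary -/

/-- `K` is a convex body of `ℝ^d` (compact, convex, with nonempty interior) whose boundary is a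
smooth hypersurface with positive definite second fundamental form: near each boundary point `x`,
`K = {ρ ≤ 0}` with `ρ` smooth, `dρ(x) ≠ 0`, and the Hessian of `ρ` at `x` is positive definite
on the tangent space `T_x ∂K = ker dρ(x)` (there the second fundamental form of `∂K` is
`D²ρ(x) / ‖∇ρ(x)‖`, so all principal curvatures are positive). -/
structure IsSmoothStrictlyConvexBody {d : ℕ} (K : Set (Euc d)) : Prop where
  isCompact : IsCompact K
  convex : Convex ℝ K
  interior_nonempty : (interior K).Nonempty
  boundary : ∀ x ∈ frontier K, ∃ ρ : Euc d → ℝ,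
    ContDiff ℝ ∞ ρ ∧ ρ x = 0 ∧ (∀ᶠ y in nhds x, (y ∈ K ↔ ρ y ≤ 0)) ∧ fderiv ℝ ρ x ≠ 0 ∧
      ∀ v : Euc d, fderiv ℝ ρ x v = 0 → v ≠ 0 → 0 < fderiv ℝ (fderiv ℝ ρ) x v v

/-- Strictly convex compact sets with smooth boundary; points are included by convention. -/
def IsStrictlyConvexSmooth {d : ℕ} (K : Set (Euc d)) : Prop :=
  (∃ x₀ : Euc d, K = {x₀}) ∨ IsSmoothStrictlyConvexBody K

/-- The outward unit normal bundle `N_+(K)`: pairs `(x, θ)` with `x ∈ ∂K` and `θ` an outward unit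
normal to `K` at `x`. If `K` is a point `x₀`, these are all the pairs `(x₀, θ)` with `|θ| = 1`. -/
def outwardNormalBundle {d : ℕ} (K : Set (Euc d)) : Set (Euc d × Euc d) :=
  {p | p.1 ∈ frontier K ∧ ‖p.2‖ = 1 ∧ ∀ y ∈ K, inner ℝ (y - p.1) p.2 ≤ 0}

/-- The unit normal bundle of `∂K` for the orientation `σ`: the outward one, `N_+(K)`, for `σ = 1`
and the inward one, `N_-(K)`, for `σ = -1`. -/
def orientedNormalBundle {d : ℕ} (σ : ℤˣ) (K : Set (Euc d)) : Set (Euc d × Euc d) :=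
  {p | (p.1, σ • p.2) ∈ outwardNormalBundle K}

/-- The projection to `𝕋^d × 𝕊^{d-1}` of the oriented unit normal bundle of `∂K`, i.e. the direct
unit normal bundle of the immersed hypersurface `Σ = 𝔭(∂K)` with the orientation `σ`. -/
def torusNormalBundle {d : ℕ} (σ : ℤˣ) (K : Set (Euc d)) : Set (FlatTorus d × Euc d) :=
  (fun p : Euc d × Euc d => (torusProj p.1, p.2)) '' orientedNormalBundle σ K

/-! ### Geodesic arcs and orthogeodesics -/

/-- A geodesic arc of positive length on the flat torus, parametrized by arc length. It is the
curve `t ∈ [0, length] ↦ start + t • dir` (modulo `2πℤ^d`), and is determined by its starting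
point, its (constant) unit velocity and its length. -/
@[ext]
structure GeodesicArc (d : ℕ) where
  start : FlatTorus d
  dir : Euc d
  length : ℝ
  norm_dir : ‖dir‖ = 1
  length_pos : 0 < length

/-- The point at time `t` of a geodesic arc. -/
noncomputable def GeodesicArc.point {d : ℕ} (γ : GeodesicArc d) (t : ℝ) : FlatTorus d :=
  γ.start + torusProj (t • γ.dir)

/-- The set `P_{K₁,K₂}` of orthogeodesics: the geodesic arcs that start on `Σ₁ = 𝔭(∂K₁)`, end on
`Σ₂ = 𝔭(∂K₂)`, and whose velocities there are the unit normals given by the orientations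
`σ₁` and `σ₂`. -/
def orthogeodesics {d : ℕ} (σ₁ σ₂ : ℤˣ) (K₁ K₂ : Set (Euc d)) : Set (GeodesicArc d) :=
  {γ | (γ.point 0, γ.dir) ∈ torusNormalBundle σ₁ K₁ ∧
    (γ.point γ.length, γ.dir) ∈ torusNormalBundle σ₂ K₂}

/-- The orthogeodesics of length greater than `T₀`. -/
def longOrthogeodesics {d : ℕ} (σ₁ σ₂ : ℤˣ) (K₁ K₂ : Set (Euc d)) (T₀ : ℝ) :
    Set (GeodesicArc d) :=
  {γ | γ ∈ orthogeodesics σ₁ σ₂ K₁ K₂ ∧ T₀ < γ.length}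

/-- `T₀ > 0` is such that, for every `T > 0`, there are only finitely many orthogeodesics
with length in `(T₀, T]`. -/
def IsLengthThreshold {d : ℕ} (σ₁ σ₂ : ℤˣ) (K₁ K₂ : Set (Euc d)) (T₀ : ℝ) : Prop :=
  0 < T₀ ∧ ∀ T : ℝ, 0 < T → {γ ∈ longOrthogeodesics σ₁ σ₂ K₁ K₂ T₀ | γ.length ≤ T}.Finite

/-! ### Closed one-forms on the torus -/

/-- A real one-form on `𝕋^d`. The cotangent bundle is trivialized by `dx₁, …, dx_d`, so that a
one-form is a map from the torus to the linear forms on `ℝ^d`. -/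
abbrev TorusOneForm (d : ℕ) : Type := FlatTorus d → (Euc d →L[ℝ] ℝ)

/-- `β` is a smooth closed one-form: its lift to `ℝ^d` is smooth, and `dβ = 0`, where
`dβ(v, w) = (D_v β)(w) - (D_w β)(v)`. -/
structure IsSmoothClosed {d : ℕ} (β : TorusOneForm d) : Prop where
  smooth : ContDiff ℝ ∞ (fun x : Euc d => β (torusProj x))
  closed : ∀ x v w : Euc d,
    fderiv ℝ (fun x : Euc d => β (torusProj x)) x v w =
      fderiv ℝ (fun x : Euc d => β (torusProj x)) x w v

/-- The cohomology class of `β` is `∑ bᵢ dxᵢ`: there is a smooth `f : 𝕋^d → ℝ` such that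
`β = ∑ bᵢ dxᵢ + df`. -/
def HasCohomologyClass {d : ℕ} (β : TorusOneForm d) (b : Fin d → ℝ) : Prop :=
  ∃ f : FlatTorus d → ℝ, ContDiff ℝ ∞ (fun x : Euc d => f (torusProj x)) ∧
    ∀ x v : Euc d, β (torusProj x) v =
      ∑ i, b i * v i + fderiv ℝ (fun x : Euc d => f (torusProj x)) x v

/-- The cohomology class of `β` belongs to `H¹(𝕋^d, ℤ)`, i.e. it is `∑ nᵢ dxᵢ` with `nᵢ ∈ ℤ`. -/
def HasIntegralClass {d : ℕ} (β : TorusOneForm d) : Prop :=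
  ∃ n : Fin d → ℤ, HasCohomologyClass β (fun i => (n i : ℝ))

/-- The integral `∫_γ β` of a one-form along a geodesic arc. -/
noncomputable def GeodesicArc.integral {d : ℕ} (γ : GeodesicArc d) (β : TorusOneForm d) : ℝ :=
  ∫ t in (0 : ℝ)..γ.length, β (γ.point t) γ.dir

/-- The term `e^{i ∫_γ β} ℓ(γ)^{-s}` of the generalized Epstein zeta function. -/
noncomputable def epsteinTerm {d : ℕ} (β : TorusOneForm d) (s : ℂ) (γ : GeodesicArc d) : ℂ :=
  Complex.exp (Complex.I * (γ.integral β : ℂ)) / (γ.length : ℂ) ^ s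

/-- `F` extends the generalized Epstein zeta function `ζ_β(K₁, K₂, s)`: for `Re s > d`, the series
over the orthogeodesics of length greater than `T₀` converges (absolutely) to `F s`. -/
def ExtendsEpsteinZeta {d : ℕ} (σ₁ σ₂ : ℤˣ) (K₁ K₂ : Set (Euc d)) (β : TorusOneForm d) (T₀ : ℝ)
    (F : ℂ → ℂ) : Prop :=
  ∀ s : ℂ, (d : ℝ) < s.re →
    HasSum (fun γ : longOrthogeodesics σ₁ σ₂ K₁ K₂ T₀ => epsteinTerm β s γ.1) (F s)

/-! Positive curvature makes the Gauss map of each `K_j` invertible: the boundary point with chosen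
unit normal `θ` is a smooth function `Y_j(θ)`, extended to be homogeneous of degree 0
(`exists_gaussInverse`). An orthogeodesic of length `ℓ` and direction `θ` is then a vector `x = ℓ θ`
with `x + V(x) = 2πn`, where `V = Y₁ - Y₂` and `n ∈ ℤ^d`. Since `V` is bounded and `DV` is
homogeneous of degree `-1`, the map `x ↦ x + V(x)` is invertible far from the origin, with inverse
`Φ`. Writing `β = b·dx + df`, the phase splits into the character `n ↦ e^{2πi b·n}` and a function
`G(x)` homogeneous of degree 0. Up to finitely many terms, the zeta function is therefore a lattice
sum of the symbol `F_s = (G |·|^{-s}) ∘ Φ`, twisted by this character.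

The analytic input is that an `N`-th finite difference of `F_s` with bounded step gains a factor
`|ξ|^{-N}` (`exists_isInverseOutside`). This follows by rescaling to the unit sphere, where `Φ`
becomes a smooth family with compact parameter space.

If `b` is not integral, the character is nontrivial and `N` summations by parts give convergence for
`Re s > d - N`, for every `N`; the continuation is entire (`exists_entire_of_character_ne_one`).

If `b` is integral, the character is trivial. Averaging the `(N+1)`-st difference over steps `y` in
a fundamental cell and summing over the lattice gives, up to sign, the cell volume times the lattice
sum, minus `∫ F_s`. Every term with a nonzero multiple `k y` contributes the same integral, because
the dilated cells still cover `ℝ^d` uniformly. So the lattice sum is an entire function plus a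
constant multiple of `∫ F_s` (`exists_entire_sub_integral`).

The substitution `ξ = x + V(x)` turns that integral into one of `G |x|^{-s} det(1 + DV)`. As `V` is
constant along rays, `DV(x) x = 0`; the determinant therefore expands in `|x|^{-k}` with `k < d`
only. In polar coordinates the `k`-th term has a single simple fraction at `s = d - k`, which leaves
exactly the candidates `1, …, d` (`exists_integral_symbolTerm`). -/

open Filter Topology Set MeasureTheory

/-! ### Inverse Gauss maps of strictly convex sets -/

section GaussMap

variable {d : ℕ} {K : Set (Euc d)}

/-- The gradient of a function on `ℝ^d`. -/
noncomputable def grad (ρ : Euc d → ℝ) (x : Euc d) : Euc d :=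
  (InnerProductSpace.toDual ℝ (Euc d)).symm (fderiv ℝ ρ x)

theorem inner_grad (ρ : Euc d → ℝ) (x v : Euc d) : inner ℝ (grad ρ x) v = fderiv ℝ ρ x v := by
  simp [grad]

theorem contDiff_grad {ρ : Euc d → ℝ} (hρ : ContDiff ℝ ∞ ρ) : ContDiff ℝ ∞ (grad ρ) := by
  have h1 : ContDiff ℝ ∞ (fderiv ℝ ρ) := hρ.fderiv_right (by simp)
  exact ((InnerProductSpace.toDual ℝ (Euc d)).symm.toContinuousLinearEquiv.toContinuousLinearMap
    |>.restrictScalars ℝ).contDiff.comp h1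

theorem hasFDerivAt_grad {ρ : Euc d → ℝ} (hρ : ContDiff ℝ ∞ ρ) (x : Euc d) :
    ∃ g' : Euc d →L[ℝ] Euc d, HasFDerivAt (grad ρ) g' x ∧
      ∀ u v, inner ℝ (g' u) v = fderiv ℝ (fderiv ℝ ρ) x u v := by
  have h1 : ContDiff ℝ ∞ (fderiv ℝ ρ) := hρ.fderiv_right (by simp)
  have h2 : HasFDerivAt (fderiv ℝ ρ) (fderiv ℝ (fderiv ℝ ρ) x) x :=
    (h1.differentiable (by simp) x).hasFDerivAt
  refine ⟨_, (((InnerProductSpace.toDual ℝ (Euc d)).symm.toContinuousLinearEquiv.toContinuousLinearMap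
    |>.restrictScalars ℝ).hasFDerivAt (x := fderiv ℝ ρ x)).comp x h2, fun u v => ?_⟩
  simp

/-- A vector whose polar contains an open half-space is a multiple of the normal. -/
theorem eq_norm_smul_of_forall_inner_neg {F : Type*} [NormedAddCommGroup F]
    [InnerProductSpace ℝ F] {g θ : F} (hg : g ≠ 0) (hθ : ‖θ‖ = 1)
    (h : ∀ w : F, inner ℝ g w < 0 → inner ℝ w θ ≤ 0) : g = ‖g‖ • θ := by
  set a : ℝ := inner ℝ g θ with ha
  have hg0 : 0 < ‖g‖ := norm_pos_iff.2 hg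
  -- The test vector is `θ - t • g`. Letting `t` decrease to `a / ‖g‖ ^ 2` forces `‖g‖ ≤ a`, the
  -- equality case of Cauchy–Schwarz.
  have key : ∀ t : ℝ, a < t * ‖g‖ ^ 2 → 1 ≤ t * a := by
    intro t ht
    have h1 := h (θ - t • g) (by
      rw [inner_sub_right, inner_smul_right, real_inner_self_eq_norm_sq]; linarith)
    rw [inner_sub_left, inner_smul_left, real_inner_self_eq_norm_sq, hθ] at h1
    simp only [conj_trivial] at h1
    linarith
  have ha0 : 0 < a := by
    have h1 := key ((|a| + 1) / ‖g‖ ^ 2) (by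
      rw [div_mul_cancel₀ _ (by positivity)]; linarith [le_abs_self a])
    by_contra hcon
    have : (|a| + 1) / ‖g‖ ^ 2 * a ≤ 0 := mul_nonpos_of_nonneg_of_nonpos (by positivity) (by linarith)
    linarith
  have hle : ‖g‖ ≤ a := by
    by_contra hcon
    push Not at hcon
    have h1 : a / ‖g‖ ^ 2 < 1 / a := by
      rw [div_lt_div_iff₀ (by positivity) ha0]; nlinarith
    obtain ⟨t, ht1, ht2⟩ := exists_between h1
    have h2 := key t ((div_lt_iff₀ (by positivity)).1 ht1)
    have h3 := (lt_div_iff₀ ha0).1 ht2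
    linarith
  have hle' : a ≤ ‖g‖ := by simpa [hθ] using real_inner_le_norm g θ
  have heq : inner ℝ g θ = ‖g‖ * ‖θ‖ := by rw [hθ, mul_one, ← ha]; linarith
  have := inner_eq_norm_mul_iff_real.1 heq
  rw [hθ, one_smul] at this
  exact this

theorem eventually_lt_of_fderiv_neg {ρ : Euc d → ℝ} {x w : Euc d} (hρ : DifferentiableAt ℝ ρ x)
    (hw : fderiv ℝ ρ x w < 0) : ∀ᶠ t in 𝓝[>] (0 : ℝ), ρ (x + t • w) < ρ x := by
  have h1 : HasDerivAt (fun t : ℝ => ρ (x + t • w)) (fderiv ℝ ρ x w) 0 := by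
    have h2 : HasDerivAt (fun t : ℝ => x + t • w) w 0 := by
      simpa using ((hasDerivAt_id (0 : ℝ)).smul_const w).const_add x
    have h3 : HasFDerivAt ρ (fderiv ℝ ρ x) (x + (0 : ℝ) • w) := by
      simpa using hρ.hasFDerivAt
    exact h3.comp_hasDerivAt 0 h2
  have h2 := (hasDerivAt_iff_tendsto_slope.1 h1).eventually (gt_mem_nhds hw)
  have h3 : ∀ᶠ t in 𝓝[>] (0 : ℝ), slope (fun t : ℝ => ρ (x + t • w)) 0 t < 0 :=
    h2.filter_mono (nhdsWithin_mono _ (fun t ht => (ne_of_gt ht)))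
  filter_upwards [h3, self_mem_nhdsWithin] with t ht ht0
  simp only [slope, vsub_eq_sub, sub_zero, zero_smul, add_zero, smul_eq_mul] at ht
  have ht0' : (0 : ℝ) < t := ht0
  by_contra hcon
  exact absurd ht (not_lt.2 (mul_nonneg (inv_pos.2 ht0').le (by linarith)))

/-- An outward unit normal is the normalized gradient of a local defining function. -/
theorem grad_eq_norm_smul {ρ : Euc d → ℝ} {x θ : Euc d} (hρ : ContDiff ℝ ∞ ρ) (h0 : ρ x = 0)
    (hK : ∀ᶠ y in 𝓝 x, (y ∈ K ↔ ρ y ≤ 0)) (hg : grad ρ x ≠ 0) (hθ : ‖θ‖ = 1)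
    (hn : ∀ y ∈ K, inner ℝ (y - x) θ ≤ 0) : grad ρ x = ‖grad ρ x‖ • θ := by
  refine eq_norm_smul_of_forall_inner_neg hg hθ fun w hw => ?_
  rw [inner_grad] at hw
  have h1 := eventually_lt_of_fderiv_neg (hρ.differentiable (by simp) x) hw
  have h2 : Tendsto (fun t : ℝ => x + t • w) (𝓝[>] 0) (𝓝 x) := by
    have : Tendsto (fun t : ℝ => x + t • w) (𝓝 0) (𝓝 (x + (0 : ℝ) • w)) :=
      (Continuous.tendsto (by fun_prop) 0)
    simp only [zero_smul, add_zero] at this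
    exact this.mono_left nhdsWithin_le_nhds
  obtain ⟨t, ht1, ht2, ht0⟩ := (h1.and ((h2.eventually hK).and self_mem_nhdsWithin)).exists
  have h3 := hn _ (ht2.2 (by linarith))
  rw [add_sub_cancel_left, inner_smul_left] at h3
  simp only [conj_trivial] at h3
  have ht0' : (0 : ℝ) < t := ht0
  by_contra hcon
  push Not at hcon
  have := mul_pos ht0' hcon
  linarith

theorem grad_ne_zero {ρ : Euc d → ℝ} {x : Euc d} (h : fderiv ℝ ρ x ≠ 0) : grad ρ x ≠ 0 := by
  simpa [grad] using h

theorem pos_of_second_deriv_pos {φ : ℝ → ℝ} (hφ : ContDiff ℝ ∞ φ) (h0 : φ 0 = 0)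
    (h1 : deriv φ 0 = 0) (h2 : 0 < deriv (deriv φ) 0) : ∀ᶠ t in 𝓝[>] (0 : ℝ), 0 < φ t := by
  have hd : Differentiable ℝ φ := hφ.differentiable (by simp)
  have hφ' : ContDiff ℝ ∞ (deriv φ) := (contDiff_infty_iff_deriv.1 hφ).2
  have h3 : HasDerivAt (deriv φ) (deriv (deriv φ) 0) 0 :=
    (hφ'.differentiable (by simp) 0).hasDerivAt
  have h4 := (hasDerivAt_iff_tendsto_slope.1 h3).eventually (lt_mem_nhds h2)
  have h5 : ∀ᶠ t in 𝓝[>] (0 : ℝ), 0 < deriv φ t := by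
    have h6 : ∀ᶠ t in 𝓝[>] (0 : ℝ), 0 < slope (deriv φ) 0 t :=
      h4.filter_mono (nhdsWithin_mono _ (fun t ht => (ne_of_gt ht)))
    filter_upwards [h6, self_mem_nhdsWithin] with t ht ht0
    have ht0' : (0 : ℝ) < t := ht0
    simp only [slope, vsub_eq_sub, sub_zero, h1, smul_eq_mul] at ht
    exact (mul_pos_iff_of_pos_left (inv_pos.2 ht0')).1 ht
  obtain ⟨δ, hδ, hδ'⟩ := mem_nhdsGT_iff_exists_Ioo_subset.1 h5
  have hδ0 : (0 : ℝ) < δ := hδ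
  filter_upwards [Ioo_mem_nhdsGT hδ0] with t ht
  have hmono : StrictMonoOn φ (Icc 0 t) := by
    refine strictMonoOn_of_deriv_pos (convex_Icc 0 t) hd.continuous.continuousOn fun s hs => ?_
    rw [interior_Icc] at hs
    exact hδ' ⟨hs.1, hs.2.trans ht.2⟩
  have := hmono ⟨le_rfl, ht.1.le⟩ ⟨ht.1.le, le_rfl⟩ ht.1
  linarith

/-- If two points share the normal `θ`, their chord is orthogonal to `θ`, hence tangent to the
boundary at `x`. Positive curvature makes `ρ > 0` on the chord just past `x`, while convexity keeps
the chord in `K`. -/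
theorem eq_of_mem_outwardNormalBundle (hK : IsSmoothStrictlyConvexBody K) {x y θ : Euc d}
    (hx : (x, θ) ∈ outwardNormalBundle K) (hy : (y, θ) ∈ outwardNormalBundle K) : x = y := by
  obtain ⟨hxf, hθ, hxn⟩ := hx
  obtain ⟨hyf, -, hyn⟩ := hy
  simp only at hxf hθ hxn hyf hyn
  have hcl := hK.isCompact.isClosed
  have hxK : x ∈ K := hcl.frontier_subset hxf
  have hyK : y ∈ K := hcl.frontier_subset hyf
  by_contra hne
  obtain ⟨ρ, hρ, h0, hloc, hd, hpos⟩ := hK.boundary x hxf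
  have hg := grad_eq_norm_smul hρ h0 hloc (grad_ne_zero hd) hθ hxn
  have hv0 : fderiv ℝ ρ x (y - x) = 0 := by
    rw [← inner_grad, hg, inner_smul_left, real_inner_comm]
    have h1 := hxn y hyK
    have h2 := hyn x hxK
    have h3 : inner ℝ (y - x) θ = (0 : ℝ) := by
      have : inner ℝ (x - y) θ = - inner ℝ (y - x) θ := by rw [← inner_neg_left, neg_sub]
      linarith
    rw [h3, mul_zero]
  have hpp := hpos (y - x) hv0 (sub_ne_zero.2 (Ne.symm hne))
  set v := y - x with hv
  have hline : ∀ t : ℝ, HasDerivAt (fun t : ℝ => x + t • v) v t := fun t => by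
    simpa using ((hasDerivAt_id t).smul_const v).const_add x
  have hd1 : ∀ t : ℝ, HasDerivAt (fun t : ℝ => ρ (x + t • v)) (fderiv ℝ ρ (x + t • v) v) t :=
    fun t => ((hρ.differentiable (by simp) _).hasFDerivAt).comp_hasDerivAt t (hline t)
  have hderiv : deriv (fun t : ℝ => ρ (x + t • v)) = fun t => fderiv ℝ ρ (x + t • v) v :=
    funext fun t => (hd1 t).deriv
  have hρ' : ContDiff ℝ ∞ (fderiv ℝ ρ) := hρ.fderiv_right (by simp)
  have hd2 : HasDerivAt (fun t : ℝ => fderiv ℝ ρ (x + t • v) v)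
      (fderiv ℝ (fderiv ℝ ρ) (x + (0 : ℝ) • v) v v) 0 := by
    have := ((hρ'.differentiable (by simp) _).hasFDerivAt).comp_hasDerivAt (0 : ℝ) (hline 0)
    exact this.clm_apply (hasDerivAt_const (0 : ℝ) v) |>.congr_deriv (by simp)
  have hev := pos_of_second_deriv_pos (φ := fun t : ℝ => ρ (x + t • v))
    (hρ.comp (by fun_prop)) (by simpa using h0) (by rw [hderiv]; simpa using hv0)
    (by rw [hderiv, hd2.deriv]; simpa using hpp)
  have h2 : Tendsto (fun t : ℝ => x + t • v) (𝓝[>] 0) (𝓝 x) := by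
    have : Tendsto (fun t : ℝ => x + t • v) (𝓝 0) (𝓝 (x + (0 : ℝ) • v)) :=
      (Continuous.tendsto (by fun_prop) 0)
    simp only [zero_smul, add_zero] at this
    exact this.mono_left nhdsWithin_le_nhds
  obtain ⟨t, ht1, ht2, ht3⟩ :=
    (hev.and ((h2.eventually hloc).and (Ioo_mem_nhdsGT (zero_lt_one' ℝ)))).exists
  have hmem : x + t • v ∈ K := hK.convex.add_smul_sub_mem hxK hyK ⟨ht3.1.le, ht3.2.le⟩
  linarith [ht2.1 hmem]

/-- The height function in the direction `θ` attains its maximum on `K`, and never at an interior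
point. -/
theorem exists_mem_outwardNormalBundle (hK : IsSmoothStrictlyConvexBody K) {θ : Euc d}
    (hθ : ‖θ‖ = 1) : ∃ x, (x, θ) ∈ outwardNormalBundle K := by
  obtain ⟨x, hxK, hx⟩ := hK.isCompact.exists_isMaxOn (hK.interior_nonempty.mono interior_subset)
    (f := fun y : Euc d => inner ℝ y θ) (by fun_prop)
  have hn : ∀ y ∈ K, inner ℝ (y - x) θ ≤ 0 := fun y hy => by
    rw [inner_sub_left]
    have := hx hy
    simp only [mem_ofPred_eq] at this
    linarith
  refine ⟨x, ?_, hθ, hn⟩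
  rw [hK.isCompact.isClosed.frontier_eq]
  refine ⟨hxK, fun hint => ?_⟩
  have h2 : Tendsto (fun t : ℝ => x + t • θ) (𝓝[>] 0) (𝓝 x) := by
    have : Tendsto (fun t : ℝ => x + t • θ) (𝓝 0) (𝓝 (x + (0 : ℝ) • θ)) :=
      (Continuous.tendsto (by fun_prop) 0)
    simp only [zero_smul, add_zero] at this
    exact this.mono_left nhdsWithin_le_nhds
  obtain ⟨t, ht, ht0⟩ :=
    ((h2.eventually (mem_interior_iff_mem_nhds.1 hint)).and self_mem_nhdsWithin).exists
  have h3 := hn _ ht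
  rw [add_sub_cancel_left, inner_smul_left, real_inner_self_eq_norm_sq, hθ] at h3
  simp only [conj_trivial] at h3
  have ht0' : (0 : ℝ) < t := ht0
  linarith

/-- The normal condition is closed, so every cluster point of `X η` as `η → θ` is a boundary point
with normal `θ`, and that point is unique; compactness of the boundary does the rest. -/
theorem continuousWithinAt_of_mem_outwardNormalBundle (hK : IsSmoothStrictlyConvexBody K)
    {X : Euc d → Euc d} (hX : ∀ θ : Euc d, ‖θ‖ = 1 → (X θ, θ) ∈ outwardNormalBundle K)
    {θ : Euc d} (hθ : ‖θ‖ = 1) : Tendsto X (𝓝[{θ | ‖θ‖ = 1}] θ) (𝓝 (X θ)) := by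
  have hcl := hK.isCompact.isClosed
  refine (hK.isCompact.of_isClosed_subset isClosed_frontier
    hcl.frontier_subset).tendsto_nhds_of_unique_mapClusterPt
    (eventually_mem_nhdsWithin.mono fun η hη => (hX η hη).1) fun y hy hcp => ?_
  obtain ⟨U, hU, hUy⟩ := mapClusterPt_iff_ultrafilter.1 hcp
  refine eq_of_mem_outwardNormalBundle hK ⟨hy, hθ, fun z hz => ?_⟩ (hX θ hθ)
  have h1 : Tendsto (fun η : Euc d => inner ℝ (z - X η) η) U (𝓝 (inner ℝ (z - y) θ)) :=
    (tendsto_const_nhds.sub hUy).inner (hU.trans nhdsWithin_le_nhds)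
  exact le_of_tendsto h1 (hU (eventually_mem_nhdsWithin.mono fun η hη => (hX η hη).2.2 z hz))

/-- The map whose local inverse parametrizes the boundary by the normal direction. -/
theorem exists_equiv_hasFDerivAt {ρ : Euc d → ℝ} {p θ : Euc d} (hρ : ContDiff ℝ ∞ ρ)
    (hg : grad ρ p = ‖grad ρ p‖ • θ) (hg0 : grad ρ p ≠ 0) (hθ : ‖θ‖ = 1)
    (hpos : ∀ v : Euc d, fderiv ℝ ρ p v = 0 → v ≠ 0 → 0 < fderiv ℝ (fderiv ℝ ρ) p v v) :
    ∃ M' : Euc d ≃L[ℝ] Euc d, HasFDerivAt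
      (fun y => (inner ℝ (grad ρ y) θ)⁻¹ • grad ρ y + ρ y • θ) (M' : Euc d →L[ℝ] Euc d) p := by
  obtain ⟨g', hg', hg'i⟩ := hasFDerivAt_grad hρ p
  have hρ' : HasFDerivAt ρ (fderiv ℝ ρ p) p := (hρ.differentiable (by simp) p).hasFDerivAt
  have hin : inner ℝ (grad ρ p) θ = ‖grad ρ p‖ := by
    rw [hg, inner_smul_left, real_inner_self_eq_norm_sq, hθ]
    simp [norm_smul, hθ]
  have hn0 : 0 < ‖grad ρ p‖ := norm_pos_iff.2 hg0
  have hk : DifferentiableAt ℝ (fun y => (inner ℝ (grad ρ y) θ)⁻¹) p := by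
    refine DifferentiableAt.inv (hg'.differentiableAt.inner ℝ (differentiableAt_const θ)) ?_
    rw [hin]; exact hn0.ne'
  have hM := (hk.hasFDerivAt.smul hg').add (hρ'.smul_const θ)
  set M' := (inner ℝ (grad ρ p) θ)⁻¹ • g' +
    (fderiv ℝ (fun y => (inner ℝ (grad ρ y) θ)⁻¹) p).smulRight (grad ρ p) +
    (fderiv ℝ ρ p).smulRight θ with hM'
  -- Pairing the map with `θ` gives `1 + ρ` near `p`, so a kernel vector `u` is tangent. Then `⟪M'
  -- u, u⟫ = ‖grad ρ p‖⁻¹ D²ρ(u, u)`, because the other two terms are multiples of `grad ρ p ⟂ u`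
  -- and of `Dρ(p) u = 0`. Positive curvature forces `u = 0`.
  have hinj : Function.Injective M' := by
    refine (injective_iff_map_eq_zero M').2 fun u hu => ?_
    have h1 : fderiv ℝ ρ p u = 0 := by
      have hA : HasFDerivAt (fun y => inner ℝ θ
          ((inner ℝ (grad ρ y) θ)⁻¹ • grad ρ y + ρ y • θ)) ((innerSL ℝ θ).comp M') p :=
        (innerSL ℝ θ).hasFDerivAt.comp p hM
      have hB : HasFDerivAt (fun y => 1 + ρ y) (fderiv ℝ ρ p) p := hρ'.const_add 1
      have hne : ∀ᶠ y in 𝓝 p, inner ℝ (grad ρ y) θ ≠ 0 :=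
        (hg'.continuousAt.inner continuousAt_const).eventually_ne (by rw [hin]; exact hn0.ne')
      have hAB := hA.congr_of_eventuallyEq (f₁ := fun y => 1 + ρ y) (by
        filter_upwards [hne] with y hy
        rw [inner_add_right, inner_smul_right, inner_smul_right, real_inner_self_eq_norm_sq, hθ,
          real_inner_comm (grad ρ y) θ, inv_mul_cancel₀ hy]
        ring)
      rw [hB.unique hAB]
      simp [hu]
    by_contra hu0
    have h2 := hpos u h1 hu0
    have h3 : inner ℝ (M' u) u = (0 : ℝ) := by rw [hu, inner_zero_left]
    have h4 : inner ℝ (grad ρ p) u = (0 : ℝ) := by rw [inner_grad, h1]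
    have h5 : M' u = (inner ℝ (grad ρ p) θ)⁻¹ • g' u +
      (fderiv ℝ (fun y => (inner ℝ (grad ρ y) θ)⁻¹) p u) • (grad ρ p) +
      (fderiv ℝ ρ p u) • θ := by simp [hM']
    rw [h5, h1, inner_add_left, inner_add_left, inner_smul_left, inner_smul_left, inner_smul_left,
      h4, hg'i, hin] at h3
    simp only [conj_trivial, mul_zero, add_zero, zero_mul] at h3
    have := mul_pos (inv_pos.2 hn0) h2
    linarith
  refine ⟨(LinearEquiv.ofInjectiveEndo M'.toLinearMap hinj).toContinuousLinearEquiv, ?_⟩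
  convert! hM using 1

theorem contDiffAt_inv_norm_smul {x : Euc d} (hx : x ≠ 0) :
    ContDiffAt ℝ ∞ (fun y : Euc d => ‖y‖⁻¹ • y) x :=
  ((contDiffAt_norm ℝ hx).inv (norm_ne_zero_iff.2 hx)).smul contDiffAt_id

theorem norm_inv_norm_smul {x : Euc d} (hx : x ≠ 0) : ‖‖x‖⁻¹ • x‖ = 1 := by
  rw [norm_smul, norm_inv, norm_norm, inv_mul_cancel₀ (norm_ne_zero_iff.2 hx)]

/-- On the boundary near `p` one has `ρ = 0` and `grad ρ` is parallel to the normal, so `M (X η) =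
⟪η, θ⟫⁻¹ • η`, the central projection of `η` to the plane `⟪·, θ⟫ = 1`. Thus `X η` is the smooth
local inverse of `M` at a smooth function of `η`. Continuity of `X` is what keeps `X η` in the
domain of that inverse. -/
theorem contDiffAt_of_mem_outwardNormalBundle (hK : IsSmoothStrictlyConvexBody K)
    {X : Euc d → Euc d} (hX : ∀ θ : Euc d, ‖θ‖ = 1 → (X θ, θ) ∈ outwardNormalBundle K)
    {x : Euc d} (hx : x ≠ 0) : ContDiffAt ℝ ∞ (fun y => X (‖y‖⁻¹ • y)) x := by
  set θ := ‖x‖⁻¹ • x with hθdef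
  have hθ : ‖θ‖ = 1 := norm_inv_norm_smul hx
  set p := X θ with hp
  obtain ⟨hpf, -, hpn⟩ := hX θ hθ
  obtain ⟨ρ, hρ, h0, hloc, hd, hpos⟩ := hK.boundary p hpf
  have hg0 := grad_ne_zero hd
  have hg := grad_eq_norm_smul hρ h0 hloc hg0 hθ hpn
  obtain ⟨M', hM'⟩ := exists_equiv_hasFDerivAt hρ hg hg0 hθ hpos
  set M := fun y => (inner ℝ (grad ρ y) θ)⁻¹ • grad ρ y + ρ y • θ with hMdef
  have hin : inner ℝ (grad ρ p) θ = ‖grad ρ p‖ := by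
    rw [hg, inner_smul_left, real_inner_self_eq_norm_sq, hθ]
    simp [norm_smul, hθ]
  have hn0 : 0 < ‖grad ρ p‖ := norm_pos_iff.2 hg0
  have hgs := contDiff_grad hρ
  have hMs : ContDiffAt ℝ ∞ M p := by
    have h1 : ContDiffAt ℝ ∞ (fun y => (inner ℝ (grad ρ y) θ)⁻¹) p :=
      (hgs.contDiffAt.inner ℝ contDiffAt_const).inv (by rw [hin]; exact hn0.ne')
    exact (h1.smul hgs.contDiffAt).add (hρ.contDiffAt.smul contDiffAt_const)
  have hMp : M p = θ := by
    simp only [hMdef, hin, h0, zero_smul, add_zero]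
    nth_rw 2 [hg]
    rw [smul_smul, inv_mul_cancel₀ hn0.ne', one_smul]
  have hnn : (∞ : WithTop ℕ∞) ≠ 0 := by simp
  have hinv := hMs.to_localInverse hM' hnn
  have hleft := (hMs.hasStrictFDerivAt' hM' hnn).eventually_left_inverse
  rw [hMp] at hinv
  have hnorm : Tendsto (fun y : Euc d => ‖y‖⁻¹ • y) (𝓝 x) (𝓝[{θ | ‖θ‖ = 1}] θ) := by
    refine tendsto_nhdsWithin_iff.2 ⟨(contDiffAt_inv_norm_smul hx).continuousAt, ?_⟩
    filter_upwards [eventually_ne_nhds hx] with y hy using norm_inv_norm_smul hy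
  have hXt : Tendsto (fun y => X (‖y‖⁻¹ • y)) (𝓝 x) (𝓝 p) :=
    (continuousWithinAt_of_mem_outwardNormalBundle hK hX hθ).comp hnorm
  have hprod : ContDiffAt ℝ ∞ (fun y : Euc d =>
      (inner ℝ (‖y‖⁻¹ • y) θ)⁻¹ • (‖y‖⁻¹ • y)) x := by
    refine ContDiffAt.smul (ContDiffAt.inv
      ((contDiffAt_inv_norm_smul hx).inner ℝ contDiffAt_const) ?_) (contDiffAt_inv_norm_smul hx)
    rw [← hθdef, real_inner_self_eq_norm_sq, hθ]; norm_num
  have hval : (inner ℝ (‖x‖⁻¹ • x) θ)⁻¹ • (‖x‖⁻¹ • x) = θ := by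
    rw [← hθdef, real_inner_self_eq_norm_sq, hθ]; norm_num
  rw [← hval] at hinv
  refine (hinv.comp x hprod).congr_of_eventuallyEq ?_
  have hgne : ∀ᶠ y in 𝓝 p, grad ρ y ≠ 0 := hgs.continuous.continuousAt.eventually_ne hg0
  filter_upwards [hXt.eventually hleft, hXt.eventually hgne,
    hXt.eventually (eventually_eventually_nhds.2 hloc), eventually_ne_nhds hx] with y hy1 hy2 hy3 hy0
  have hη : ‖‖y‖⁻¹ • y‖ = 1 := norm_inv_norm_smul hy0
  set η := ‖y‖⁻¹ • y
  obtain ⟨hf, -, hn⟩ := hX η hη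
  simp only at hf hn
  have hρ0 : ρ (X η) = 0 := by
    have hmem : X η ∈ K := hK.isCompact.isClosed.frontier_subset hf
    refine le_antisymm (hy3.self_of_nhds.1 hmem) (not_lt.1 fun hlt => ?_)
    rw [hK.isCompact.isClosed.frontier_eq] at hf
    refine hf.2 (mem_interior_iff_mem_nhds.2 ?_)
    filter_upwards [hy3, hρ.continuous.continuousAt.eventually (gt_mem_nhds hlt)] with z hz1 hz2
    exact hz1.2 hz2.le
  have hgη := grad_eq_norm_smul hρ hρ0 hy3 hy2 hη hn
  have hMη : M (X η) = (inner ℝ η θ)⁻¹ • η := by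
    simp only [hMdef, hρ0, zero_smul, add_zero]
    rw [hgη, inner_smul_left, smul_smul]
    simp only [conj_trivial]
    rw [mul_inv, mul_comm _ ‖grad ρ (X η)‖, ← mul_assoc, mul_inv_cancel₀ (norm_ne_zero_iff.2 hy2),
      one_mul]
  rw [Function.comp_apply, ← hMη]
  exact hy1.symm

/-- The outward unit normal bundle of a strictly convex set with smooth boundary is the graph of
a smooth map on the sphere, here extended to be homogeneous of degree `0`. -/
theorem IsStrictlyConvexSmooth.exists_gaussInverse (hK : IsStrictlyConvexSmooth K) :
    ∃ X : Euc d → Euc d, (∀ x ≠ 0, ContDiffAt ℝ ∞ X x) ∧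
      (∀ (r : ℝ) (x : Euc d), 0 < r → X (r • x) = X x) ∧
      ∀ x θ : Euc d, ‖θ‖ = 1 → ((x, θ) ∈ outwardNormalBundle K ↔ x = X θ) := by
  rcases hK with ⟨x₀, rfl⟩ | hK
  · refine ⟨fun _ => x₀, fun _ _ => contDiffAt_const, fun _ _ _ => rfl, fun x θ hθ => ?_⟩
    -- In dimension 0 a point is open and has empty frontier; the unit vector `θ` excludes this
    -- case.
    have : Nontrivial (Euc d) := ⟨θ, 0, fun h => by simp [h] at hθ⟩
    have hfr : frontier ({x₀} : Set (Euc d)) = {x₀} := by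
      rw [isClosed_singleton.frontier_eq, interior_singleton, sdiff_empty]
    simp only [outwardNormalBundle, mem_ofPred_eq, hfr, mem_singleton_iff, hθ, true_and]
    constructor
    · exact fun h => h.1
    · rintro rfl
      simp
  · choose! X hX using fun θ (hθ : ‖θ‖ = 1) => exists_mem_outwardNormalBundle hK hθ
    refine ⟨fun y => X (‖y‖⁻¹ • y), fun x hx => contDiffAt_of_mem_outwardNormalBundle hK hX hx,
      fun r x hr => ?_, fun x θ hθ => ?_⟩
    · simp only
      rw [norm_smul, Real.norm_of_nonneg hr.le, mul_inv, smul_smul, mul_right_comm,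
        inv_mul_cancel₀ hr.ne', one_mul]
    · simp only [hθ, inv_one, one_smul]
      exact ⟨fun h => eq_of_mem_outwardNormalBundle hK h (hX θ hθ), fun h => h ▸ hX θ hθ⟩

end GaussMap

/-! ### The torus and its closed one-forms -/

section Torus

variable {d : ℕ}

/-- The lattice vector `2πn`. -/
noncomputable def latticeVec (n : Fin d → ℤ) : Euc d := WithLp.toLp 2 fun i => 2 * Real.pi * n i

@[simp] theorem latticeVec_apply (n : Fin d → ℤ) (i : Fin d) :
    latticeVec n i = 2 * Real.pi * n i := rfl

theorem latticeVec_add (n m : Fin d → ℤ) : latticeVec (n + m) = latticeVec n + latticeVec m := by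
  ext i; simp [mul_add]

theorem torusProj_add (x y : Euc d) : torusProj (x + y) = torusProj x + torusProj y := by
  funext i; simp [torusProj]

theorem torusProj_eq_iff {x y : Euc d} :
    torusProj x = torusProj y ↔ ∃ n : Fin d → ℤ, x = y + latticeVec n := by
  constructor
  · intro h
    have : ∀ i, ∃ n : ℤ, n • (2 * Real.pi) = x i - y i := fun i => by
      rw [← AddCircle.coe_eq_zero_iff, AddCircle.coe_sub, sub_eq_zero]
      exact congrFun h i
    choose n hn using this
    refine ⟨n, ?_⟩
    ext i
    have := hn i
    rw [zsmul_eq_mul] at this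
    simp only [PiLp.add_apply, latticeVec_apply]
    linarith
  · rintro ⟨n, rfl⟩
    funext i
    simp only [torusProj, PiLp.add_apply, latticeVec_apply, AddCircle.coe_add]
    rw [add_eq_left, AddCircle.coe_eq_zero_iff]
    exact ⟨n i, by rw [zsmul_eq_mul]; ring⟩

theorem torusProj_add_latticeVec (x : Euc d) (n : Fin d → ℤ) :
    torusProj (x + latticeVec n) = torusProj x :=
  torusProj_eq_iff.2 ⟨n, rfl⟩

theorem torusProj_surjective : Function.Surjective (torusProj (d := d)) := fun y => by
  choose x hx using fun i => QuotientAddGroup.mk_surjective (y i)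
  exact ⟨WithLp.toLp 2 x, funext hx⟩

theorem hasFDerivAt_sum_mul (b : Fin d → ℝ) (x : Euc d) :
    HasFDerivAt (fun x : Euc d => ∑ i, b i * x i)
      (∑ i, b i • (EuclideanSpace.proj i : Euc d →L[ℝ] ℝ)) x := by
  have := (∑ i, b i • (EuclideanSpace.proj i : Euc d →L[ℝ] ℝ)).hasFDerivAt (x := x)
  convert! this using 1
  ext x
  simp

/-- Every smooth closed one-form on the torus is cohomologous to a constant one. -/
theorem IsSmoothClosed.exists_hasCohomologyClass {β : TorusOneForm d} (hβ : IsSmoothClosed β) :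
    ∃ b : Fin d → ℝ, HasCohomologyClass β b := by
  obtain ⟨g, hg⟩ := (convex_univ (𝕜 := ℝ) (E := Euc d)).exists_forall_hasFDerivAt_of_fderiv_symmetric
    isOpen_univ (hβ.smooth.differentiable (by simp)).differentiableOn
    (fun x _ v w => hβ.closed x v w)
  simp only [mem_univ, forall_const] at hg
  have hgs : ContDiff ℝ ∞ g := by
    have h1 : fderiv ℝ g = fun x => β (torusProj x) := funext fun x => (hg x).fderiv
    refine contDiff_infty_iff_fderiv.2 ⟨fun x => (hg x).differentiableAt, ?_⟩
    rw [h1]; exact hβ.smooth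
  -- The derivative of the primitive `g` is periodic, so its increments along lattice vectors are
  -- constants. These periods are additive in `n` and determine `b`; subtracting `b·x` makes `g`
  -- periodic.
  have hper : ∀ (n : Fin d → ℤ) (x : Euc d), g (x + latticeVec n) - g x = g (latticeVec n) - g 0 := by
    intro n x
    have h1 : ∀ y, HasFDerivAt (fun y => g (y + latticeVec n) - g y) (0 : Euc d →L[ℝ] ℝ) y := by
      intro y
      have h2 := ((hg (y + latticeVec n)).comp y ((hasFDerivAt_id y).add_const (latticeVec n))).sub (hg y)
      rw [torusProj_add_latticeVec] at h2
      exact h2.congr_fderiv (by ext; simp)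
    have := is_const_of_fderiv_eq_zero (𝕜 := ℝ) (fun y => (h1 y).differentiableAt)
      (fun y => (h1 y).fderiv) x 0
    simpa using this
  let c : (Fin d → ℤ) →+ ℝ :=
    { toFun := fun n => g (latticeVec n) - g 0
      map_zero' := by
        have : latticeVec (0 : Fin d → ℤ) = 0 := by ext i; simp
        simp [this]
      map_add' := fun n m => by
        rw [latticeVec_add, ← hper m (latticeVec n)]; ring }
  have hc : ∀ n, c n = ∑ i, n i * c (Pi.single i 1) := fun n => by
    have := LinearMap.pi_apply_eq_sum_univ c.toIntLinearMap n
    simp only [AddMonoidHom.coe_toIntLinearMap, zsmul_eq_mul] at this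
    rw [this]
    refine Finset.sum_congr rfl fun i _ => ?_
    congr 2
    ext j
    simp [Pi.single_apply, eq_comm]
  set b : Fin d → ℝ := fun i => c (Pi.single i 1) / (2 * Real.pi) with hb
  set F : Euc d → ℝ := fun x => g x - ∑ i, b i * x i with hF
  have hFper : ∀ x n, F (x + latticeVec n) = F x := fun x n => by
    have h1 := hper n x
    have h2 : c n = g (latticeVec n) - g 0 := rfl
    have h3 : ∑ i, b i * (2 * Real.pi * n i) = c n := by
      rw [hc]
      refine Finset.sum_congr rfl fun i _ => ?_
      rw [hb]
      field_simp
    simp only [hF, PiLp.add_apply, latticeVec_apply, mul_add, Finset.sum_add_distrib, h3]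
    linarith
  -- `F` descends to the torus through an arbitrary section; periodicity makes the choice
  -- irrelevant.
  have hlift : ∀ x, F (Function.surjInv torusProj_surjective (torusProj x)) = F x := fun x => by
    obtain ⟨n, hn⟩ := torusProj_eq_iff.1
      (Function.surjInv_eq torusProj_surjective (torusProj x))
    rw [hn, hFper]
  have hFs : ContDiff ℝ ∞ F := hgs.sub (ContDiff.sum fun i _ => by fun_prop)
  refine ⟨b, fun y => F (Function.surjInv torusProj_surjective y), ?_, fun x v => ?_⟩
  · simpa only [hlift] using hFs
  · simp only [hlift]
    have h1 : HasFDerivAt F _ x := (hg x).sub (hasFDerivAt_sum_mul b x)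
    rw [show (fun x => F x) = F from rfl, h1.fderiv]
    simp

theorem GeodesicArc.point_eq {γ : GeodesicArc d} {x : Euc d} (hx : γ.start = torusProj x) (t : ℝ) :
    γ.point t = torusProj (x + t • γ.dir) := by
  rw [GeodesicArc.point, hx, torusProj_add]

/-- The integral of a closed one-form along a geodesic arc. -/
theorem GeodesicArc.integral_eq {β : TorusOneForm d} (hβ : IsSmoothClosed β) {b : Fin d → ℝ}
    {f : FlatTorus d → ℝ} (hf : ContDiff ℝ ∞ (fun x : Euc d => f (torusProj x)))
    (hb : ∀ x v : Euc d, β (torusProj x) v =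
      ∑ i, b i * v i + fderiv ℝ (fun x : Euc d => f (torusProj x)) x v)
    {γ : GeodesicArc d} {x : Euc d} (hx : γ.start = torusProj x) :
    γ.integral β = ∑ i, b i * (γ.length • γ.dir) i + f (torusProj (x + γ.length • γ.dir)) -
      f (torusProj x) := by
  have hline : ∀ t : ℝ, HasDerivAt (fun t : ℝ => x + t • γ.dir) γ.dir t := fun t => by
    simpa using ((hasDerivAt_id t).smul_const γ.dir).const_add x
  have hderiv : ∀ t : ℝ, HasDerivAt (fun t : ℝ => ∑ i, b i * (x + t • γ.dir) i +
      f (torusProj (x + t • γ.dir))) (β (torusProj (x + t • γ.dir)) γ.dir) t := by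
    intro t
    have h1 := ((hasFDerivAt_sum_mul b (x + t • γ.dir)).add
      (hf.differentiable (by simp) (x + t • γ.dir)).hasFDerivAt).comp_hasDerivAt t (hline t)
    rw [hb]
    refine h1.congr_deriv ?_
    simp
  have hcont : Continuous fun t : ℝ => β (torusProj (x + t • γ.dir)) γ.dir :=
    (hβ.smooth.continuous.comp (by fun_prop : Continuous fun t : ℝ =>
      x + t • γ.dir)).clm_apply continuous_const
  rw [GeodesicArc.integral]
  simp only [GeodesicArc.point_eq hx]
  rw [intervalIntegral.integral_eq_sub_of_hasDerivAt (fun t _ => hderiv t)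
    (hcont.intervalIntegrable _ _)]
  simp only [PiLp.add_apply, mul_add, Finset.sum_add_distrib, zero_smul, add_zero]
  ring

end Torus

/-! ### Finite differences of smooth functions -/

section FiniteDifference

theorem contDiff_fwdDiff {φ : ℝ → ℂ} (hφ : ContDiff ℝ ∞ φ) : ContDiff ℝ ∞ (fwdDiff 1 φ) :=
  (hφ.comp (contDiff_id.add contDiff_const)).sub hφ

/-- Each difference is absorbed by the mean value inequality, at the cost of one derivative and of
one more unit of length in the window. -/
theorem norm_iterate_fwdDiff_le_of_iteratedDeriv {φ : ℝ → ℂ} (hφ : ContDiff ℝ ∞ φ) {N : ℕ} {a B : ℝ}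
    (hB : ∀ t ∈ Icc a (a + N), ‖iteratedDeriv N φ t‖ ≤ B) : ‖(fwdDiff 1)^[N] φ a‖ ≤ B := by
  induction N generalizing φ with
  | zero => simpa using hB a ⟨le_rfl, by simp⟩
  | succ N ih =>
    rw [Function.iterate_succ_apply]
    refine ih (contDiff_fwdDiff hφ) fun t ht => ?_
    have hφN : ∀ s, ContDiffAt ℝ N φ s := fun s =>
      (hφ.of_le (by exact_mod_cast le_top)).contDiffAt
    have h1 : iteratedDeriv N (fwdDiff 1 φ) t = iteratedDeriv N φ (t + 1) - iteratedDeriv N φ t := by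
      have h2 : fwdDiff 1 φ = (fun s => φ (s + 1)) - φ := rfl
      have h3 : ContDiffAt ℝ N (fun s => φ (s + 1)) t :=
        ((hφ.comp (contDiff_id.add contDiff_const)).of_le (by exact_mod_cast le_top)).contDiffAt
      rw [h2, iteratedDeriv_sub h3 (hφN t), iteratedDeriv_comp_add_const]
    rw [h1]
    have h4 : ∀ s ∈ Icc t (t + 1), DifferentiableAt ℝ (iteratedDeriv N φ) s := fun s _ =>
      (hφ.differentiable_iteratedDeriv N (by exact_mod_cast WithTop.coe_lt_top N)) s
    have := Convex.norm_image_sub_le_of_norm_deriv_le (𝕜 := ℝ) h4 (C := B) (fun s hs => by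
      rw [← iteratedDeriv_succ]
      refine hB s ⟨ht.1.trans hs.1, hs.2.trans ?_⟩
      push_cast
      linarith [ht.2]) (convex_Icc t (t + 1)) (left_mem_Icc.2 (by linarith))
      (right_mem_Icc.2 (by linarith))
    simpa using this

theorem iterate_fwdDiff_comp_line {P : Type*} [AddCommGroup P] [Module ℝ P] (g : P → ℂ) (p h : P)
    (N : ℕ) : (fwdDiff h)^[N] g p = (fwdDiff 1)^[N] (fun t : ℝ => g (p + t • h)) 0 := by
  simp only [fwdDiff_iter_eq_sum_shift]
  refine Finset.sum_congr rfl fun k _ => ?_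
  congr 2
  simp [Nat.cast_smul_eq_nsmul]

/-- The `N`-th finite difference with step `h` is bounded by `‖h‖ ^ N` times the `N`-th
derivative. -/
theorem norm_iterate_fwdDiff_le {P : Type*} [NormedAddCommGroup P] [NormedSpace ℝ P] {g : P → ℂ}
    (hg : ContDiff ℝ ∞ g) {N : ℕ} {p h : P} {A : ℝ}
    (hA : ∀ t ∈ Icc (0 : ℝ) N, ‖iteratedFDeriv ℝ N g (p + t • h)‖ ≤ A) :
    ‖(fwdDiff h)^[N] g p‖ ≤ A * ‖h‖ ^ N := by
  rw [iterate_fwdDiff_comp_line]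
  refine norm_iterate_fwdDiff_le_of_iteratedDeriv (hg.comp (by fun_prop)) fun t ht => ?_
  rw [zero_add] at ht
  set T : ℝ →L[ℝ] P := (ContinuousLinearMap.id ℝ ℝ).smulRight h with hT
  have h1 : (fun t : ℝ => g (p + t • h)) = (fun q => g (p + q)) ∘ T := by
    funext t; simp [hT]
  have h2 : ContDiff ℝ ∞ (fun q => g (p + q)) := hg.comp (by fun_prop)
  change ‖iteratedDeriv N (fun t : ℝ => g (p + t • h)) t‖ ≤ _
  rw [← norm_iteratedFDeriv_eq_norm_iteratedDeriv, h1,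
    T.iteratedFDeriv_comp_right h2 t (by exact_mod_cast le_top : (N : WithTop ℕ∞) ≤ ∞)]
  refine (ContinuousMultilinearMap.norm_compContinuousLinearMap_le _ _).trans ?_
  rw [iteratedFDeriv_comp_add_left]
  have hTn : ‖T‖ = ‖h‖ := by
    simp [hT]
  simp only [Finset.prod_const, Finset.card_univ, Fintype.card_fin, hTn]
  have := hA t ht
  gcongr
  simpa [hT] using this

end FiniteDifference

/-! ### Homogeneous functions of degree zero -/

section Homogeneous

variable {E F : Type*} [NormedAddCommGroup E] [InnerProductSpace ℝ E]
  [NormedAddCommGroup F] [NormedSpace ℝ F]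

/-- A function that is smooth away from the origin and homogeneous of degree `0`. -/
structure IsSmoothHomogeneous (V : E → F) : Prop where
  contDiffAt : ∀ x ≠ 0, ContDiffAt ℝ ∞ V x
  map_smul : ∀ (r : ℝ) (x : E), 0 < r → V (r • x) = V x

/-- A smooth function vanishing near the origin and equal to `1` outside a small ball. -/
noncomputable def cutoff (x : E) : ℝ := Real.smoothTransition (32 * ‖x‖ ^ 2 - 1)

theorem contDiff_cutoff : ContDiff ℝ ∞ (cutoff : E → ℝ) :=
  Real.smoothTransition.contDiff.comp
    ((contDiff_const.mul (contDiff_norm_sq ℝ)).sub contDiff_const)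

/-- The factor 32 is chosen so that `32 * (1 / 4) ^ 2 - 1 = 1`. -/
theorem cutoff_eq_one {E : Type*} [NormedAddCommGroup E] {x : E} (hx : 1 / 4 ≤ ‖x‖) : cutoff x = 1 :=
  Real.smoothTransition.one_of_one_le (by nlinarith)

theorem cutoff_eventually_eq_zero {E : Type*} [NormedAddCommGroup E] : ∀ᶠ x : E in 𝓝 0, cutoff x = 0 := by
  have h : ContinuousAt (fun x : E => 32 * ‖x‖ ^ 2 - 1) 0 := by fun_prop
  filter_upwards [h.eventually (gt_mem_nhds (by simp : 32 * ‖(0 : E)‖ ^ 2 - 1 < 0))] with x hx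
  exact Real.smoothTransition.zero_of_nonpos hx.le

theorem contDiff_cutoff_smul {V : E → F} (hV : ∀ x ≠ 0, ContDiffAt ℝ ∞ V x) :
    ContDiff ℝ ∞ (fun x => cutoff x • V x) := by
  refine contDiff_iff_contDiffAt.2 fun x => ?_
  rcases eq_or_ne x 0 with rfl | hx
  · refine (contDiffAt_const (c := (0 : F))).congr_of_eventuallyEq ?_
    filter_upwards [cutoff_eventually_eq_zero] with x hx
    rw [hx, zero_smul]
  · exact contDiff_cutoff.contDiffAt.smul (hV x hx)

variable [FiniteDimensional ℝ E]

/-- Compactness handles the unit ball. Outside it the cutoff is inactive: the function is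
homogeneous of degree 0 and its derivative of degree `-1`, so both are dominated by their values on
the sphere. -/
theorem IsSmoothHomogeneous.exists_bound_cutoff_smul {V : E → F} (hV : IsSmoothHomogeneous V) :
    ∃ M : ℝ, 0 ≤ M ∧ (∀ x, ‖cutoff x • V x‖ ≤ M) ∧
      ∀ x, ‖fderiv ℝ (fun x => cutoff x • V x) x‖ ≤ M := by
  set W := fun x => cutoff x • V x with hW
  have hWs : ContDiff ℝ ∞ W := contDiff_cutoff_smul hV.contDiffAt
  obtain ⟨M₁, hM₁⟩ := (isCompact_closedBall (0 : E) 1).exists_bound_of_continuousOn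
    hWs.continuous.continuousOn
  obtain ⟨M₂, hM₂⟩ := (isCompact_closedBall (0 : E) 1).exists_bound_of_continuousOn
    (hWs.continuous_fderiv (by simp)).continuousOn
  have hWV : ∀ x, 1 / 4 ≤ ‖x‖ → W x = V x := fun x hx => by simp [hW, cutoff_eq_one hx]
  have hM10 := (norm_nonneg _).trans (hM₁ 0 (by simp))
  have hM20 := (norm_nonneg _).trans (hM₂ 0 (by simp))
  have hone : ∀ x : E, 1 < ‖x‖ → ‖‖x‖⁻¹ • x‖ = 1 := fun x hx => by
    rw [norm_smul, norm_inv, norm_norm, inv_mul_cancel₀ (by linarith)]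
  refine ⟨M₁ + M₂, by positivity, fun x => ?_, fun x => ?_⟩
  · rcases le_or_gt ‖x‖ 1 with hx | hx
    · linarith [hM₁ x (by simpa using hx)]
    · have h1 := hM₁ (‖x‖⁻¹ • x) (by simpa using (hone x hx).le)
      rw [hWV _ (by rw [hone x hx]; norm_num), hV.map_smul _ _ (by positivity)] at h1
      have h2 : ‖W x‖ ≤ M₁ := by rwa [hWV _ (by linarith)]
      exact h2.trans (by linarith)
  · rcases le_or_gt ‖x‖ 1 with hx | hx
    · linarith [hM₂ x (by simpa using hx)]
    · set c := ‖x‖⁻¹ with hc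
      have hc0 : 0 < c := by positivity
      have hc1 : c ≤ 1 := inv_le_one_of_one_le₀ hx.le
      have h1 := hM₂ (c • x) (by simpa using (hone x hx).le)
      have h2 : W =ᶠ[𝓝 x] fun y => W (c • y) := by
        have hA : ∀ᶠ y in 𝓝 x, 1 / 4 < ‖y‖ :=
          continuous_norm.continuousAt.eventually (lt_mem_nhds (by linarith))
        have hB : ∀ᶠ y in 𝓝 x, 1 / 4 < ‖c • y‖ :=
          (by fun_prop : ContinuousAt (fun y => ‖c • y‖) x).eventually
            (lt_mem_nhds (by simp only [hc, hone x hx]; norm_num))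
        filter_upwards [hA, hB] with y hy1 hy2
        rw [hWV _ hy1.le, hWV _ hy2.le, hV.map_smul _ _ hc0]
      rw [h2.fderiv_eq, fderiv_comp_smul, norm_smul, Real.norm_of_nonneg hc0.le]
      nlinarith [norm_nonneg (fderiv ℝ W (c • x))]

end Homogeneous

/-! ### Global inverses of perturbations of the identity -/

section Inverse

/-- A smooth map that differs from the identity by a contraction has a smooth inverse. -/
theorem exists_homeomorph_of_lipschitzWith_sub_id {P : Type*} [NormedAddCommGroup P]
    [NormedSpace ℝ P] [FiniteDimensional ℝ P] [Nontrivial P] {f : P → P} (hf : ContDiff ℝ ∞ f)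
    (hl : LipschitzWith (1 / 2) (fun x => f x - x)) :
    ∃ e : P ≃ₜ P, ⇑e = f ∧ ContDiff ℝ ∞ e.symm := by
  have : CompleteSpace P := FiniteDimensional.complete ℝ P
  have happ : ApproximatesLinearOn f
      ((ContinuousLinearEquiv.refl ℝ P : P ≃L[ℝ] P) : P →L[ℝ] P) univ (1 / 2) := by
    intro x _ y _
    have := hl.dist_le_mul x y
    rw [dist_eq_norm, dist_eq_norm] at this
    convert! this using 2
    simp only [ContinuousLinearEquiv.coe_refl, ContinuousLinearMap.coe_id', id_eq]
    abel
  have hN : ‖((ContinuousLinearEquiv.refl ℝ P).symm : P →L[ℝ] P)‖₊ = 1 := by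
    ext
    simp
  have hfd : ∀ a, HasFDerivAt f (fderiv ℝ f a) a := fun a =>
    (hf.differentiable (by simp) a).hasFDerivAt
  -- On a kernel vector `u` the derivative of `f - id` is `-u`, while its norm is at most `‖u‖ / 2`.
  have hinj : ∀ a, Function.Injective (fderiv ℝ f a) := fun a => by
    refine (injective_iff_map_eq_zero _).2 fun u hu => ?_
    have h1 : HasFDerivAt (fun x => f x - x) (fderiv ℝ f a - ContinuousLinearMap.id ℝ P) a :=
      (hfd a).sub (hasFDerivAt_id a)
    have h2 := h1.le_of_lipschitz hl
    have h3 := (fderiv ℝ f a - ContinuousLinearMap.id ℝ P).le_of_opNorm_le h2 u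
    simp only [sub_apply, hu, ContinuousLinearMap.id_apply, zero_sub,
      norm_neg] at h3
    have h4 : ((1 / 2 : NNReal) : ℝ) = 1 / 2 := by norm_num
    rw [h4] at h3
    exact norm_eq_zero.1 (le_antisymm (by linarith) (norm_nonneg u))
  refine ⟨happ.toHomeomorph f (Or.inr ?_), rfl, ?_⟩
  · rw [hN]; norm_num [div_lt_iff₀]
  · refine Homeomorph.contDiff_symm _ (f₀' := fun a =>
      (LinearEquiv.ofInjectiveEndo (fderiv ℝ f a).toLinearMap
        (hinj a)).toContinuousLinearEquiv) (fun a => ?_) hf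
    convert! hfd a using 1

variable {E : Type*} [NormedAddCommGroup E] [NormedSpace ℝ E] [FiniteDimensional ℝ E]

/-- The maps `z ↦ z + ε W z`, `|ε| ≤ ε₀`, have inverses depending smoothly on `ε = ε₀ sin τ`. -/
theorem exists_smooth_inverse_family {W : E → E} (hW : ContDiff ℝ ∞ W) {M ε₀ : ℝ} (hM0 : 0 ≤ M)
    (hε₀ : 0 < ε₀) (hε : ε₀ * (2 * M) ≤ 1 / 2) (hM : ∀ x, ‖W x‖ ≤ M)
    (hM' : ∀ x, ‖fderiv ℝ W x‖ ≤ M) :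
    ∃ H : E × ℝ → E, ContDiff ℝ ∞ H ∧
      ∀ (z Ω : E) (τ : ℝ), z + (ε₀ * Real.sin τ) • W z = Ω ↔ z = H (Ω, τ) := by
  -- Keeping `τ` as a second coordinate yields an inverse smooth jointly in `(Ω, τ)`. The sine
  -- bounds the size of the perturbation by `ε₀` for every real `τ`, so the global inversion on `E ×
  -- ℝ` applies.
  set f : E × ℝ → E × ℝ := fun p => (p.1 + (ε₀ * Real.sin p.2) • W p.1, p.2) with hf
  have hfs : ContDiff ℝ ∞ f := by
    refine ContDiff.prodMk (contDiff_fst.add (ContDiff.smul ?_ (hW.comp contDiff_fst))) contDiff_snd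
    exact contDiff_const.mul (Real.contDiff_sin.comp contDiff_snd)
  have hWl : ∀ x y, ‖W x - W y‖ ≤ M * ‖x - y‖ := fun x y =>
    convex_univ.norm_image_sub_le_of_norm_fderiv_le (𝕜 := ℝ)
      (fun z _ => hW.differentiable (by simp) z) (fun z _ => hM' z) (mem_univ y) (mem_univ x)
  have hl : LipschitzWith (1 / 2) (fun p => f p - p) := by
    refine LipschitzWith.of_dist_le_mul fun p q => ?_
    rw [dist_eq_norm, dist_eq_norm]
    have h1 : f p - p - (f q - q) =
        ((ε₀ * Real.sin p.2) • W p.1 - (ε₀ * Real.sin q.2) • W q.1, 0) := by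
      ext <;> simp [hf]
    rw [h1, Prod.norm_mk, norm_zero, max_eq_left (norm_nonneg _)]
    have h2 : (ε₀ * Real.sin p.2) • W p.1 - (ε₀ * Real.sin q.2) • W q.1 =
        ε₀ • (Real.sin p.2 • (W p.1 - W q.1) + (Real.sin p.2 - Real.sin q.2) • W q.1) := by
      module
    have h3 : ‖p.1 - q.1‖ ≤ ‖p - q‖ := norm_fst_le (p - q)
    have h4 : |p.2 - q.2| ≤ ‖p - q‖ := norm_snd_le (p - q)
    have h5 : |Real.sin p.2 - Real.sin q.2| ≤ |p.2 - q.2| := by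
      simpa [Real.dist_eq] using Real.lipschitzWith_sin.dist_le_mul p.2 q.2
    have h6 : ‖Real.sin p.2 • (W p.1 - W q.1)‖ ≤ M * ‖p - q‖ := by
      rw [norm_smul]
      calc _ ≤ 1 * (M * ‖p.1 - q.1‖) := by
            gcongr
            · exact Real.abs_sin_le_one _
            · exact hWl _ _
        _ ≤ _ := by rw [one_mul]; gcongr
    have h7 : ‖(Real.sin p.2 - Real.sin q.2) • W q.1‖ ≤ ‖p - q‖ * M := by
      rw [norm_smul]
      exact mul_le_mul (h5.trans h4) (hM _) (norm_nonneg _) (norm_nonneg _)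
    rw [h2, norm_smul, Real.norm_of_nonneg hε₀.le]
    calc _ ≤ ε₀ * (M * ‖p - q‖ + ‖p - q‖ * M) := by
          gcongr
          exact (norm_add_le _ _).trans (add_le_add h6 h7)
      _ = ε₀ * (2 * M) * ‖p - q‖ := by ring
      _ ≤ 1 / 2 * ‖p - q‖ := by gcongr
      _ = _ := by norm_num
  obtain ⟨e, he, hes⟩ := exists_homeomorph_of_lipschitzWith_sub_id hfs hl
  refine ⟨fun p => (e.symm p).1, contDiff_fst.comp hes, fun z Ω τ => ?_⟩
  have hfe : e (z, τ) = (z + (ε₀ * Real.sin τ) • W z, τ) := by rw [he]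
  constructor
  · intro h
    rw [h] at hfe
    simp only [← hfe, e.symm_apply_apply]
  · intro h
    have h1 : e (e.symm (Ω, τ)) = (Ω, τ) := e.apply_symm_apply _
    rw [he] at h1
    have h2 : (e.symm (Ω, τ)).2 = τ := congrArg Prod.snd h1
    have h3 := congrArg Prod.fst h1
    simp only [hf, h2, ← h] at h3
    exact h3

end Inverse

/-! ### Symbol estimates -/

section Symbol

variable {E : Type*} [NormedAddCommGroup E] [InnerProductSpace ℝ E]

/-- The function `ξ ↦ G(x) |x|^{-s}` with `x = Φ(ξ)`, cut off at `|x| = R`. -/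
noncomputable def symbolTerm (R : ℝ) (Φ : E → E) (G : E → ℂ) (s : ℂ) (ξ : E) : ℂ :=
  if R < ‖Φ ξ‖ then G (Φ ξ) * Complex.exp (-s * Real.log ‖Φ ξ‖) else 0

/-- `Φ` inverts `x ↦ x + V x` outside the ball of radius `R`. -/
structure IsInverseOutside (R : ℝ) (V Φ : E → E) : Prop where
  pos : 0 < R
  continuous : Continuous Φ
  eq_iff : ∀ x ξ, R < ‖x‖ → (x + V x = ξ ↔ x = Φ ξ)
  exists_bound : ∃ M, ∀ ξ, ‖Φ ξ - ξ‖ ≤ M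
  norm_fderiv_le : ∀ x, R < ‖x‖ → ‖fderiv ℝ V x‖ ≤ 1 / 2

/-- The symbol estimate of order `N` for the finite differences of `symbolTerm`. -/
def SymbolEstimate (R : ℝ) (Φ : E → E) (G : E → ℂ) : Prop :=
  ∀ (N : ℕ) (C S : ℝ), ∃ A r₀ : ℝ, 0 < r₀ ∧ 0 ≤ A ∧ ∀ (ξ y : E) (s : ℂ), r₀ ≤ ‖ξ‖ → ‖y‖ ≤ C → ‖s‖ ≤ S →
    ‖(fwdDiff y)^[N] (symbolTerm R Φ G s) ξ‖ ≤ A * ‖ξ‖ ^ (-s.re - N)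

variable [FiniteDimensional ℝ E]

/-- Put `r = ‖ξ‖` and `x = r z`. By homogeneity `x + V x = ξ` becomes `z + r⁻¹ V z = r⁻¹ ξ`, a
perturbation of the identity with small parameter `r⁻¹`, solved by a smooth family `H`. The symbol
is `r^{-s}` times a smooth function of parameters in a compact set, and a step `y` in `ξ` is a step
`r⁻¹ y` there; this is the gain of `r⁻¹` per difference. -/
theorem exists_isInverseOutside {V : E → E} (hV : IsSmoothHomogeneous V) :
    ∃ (R : ℝ) (Φ : E → E), IsInverseOutside R V Φ ∧
      ∀ G : E → ℂ, IsSmoothHomogeneous G → SymbolEstimate R Φ G := by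
  obtain ⟨M, hM0, hM, hM'⟩ := hV.exists_bound_cutoff_smul
  set W := fun x => cutoff x • V x with hW
  have hWs : ContDiff ℝ ∞ W := contDiff_cutoff_smul hV.contDiffAt
  have hWV : ∀ x, 1 / 4 ≤ ‖x‖ → W x = V x := fun x hx => by simp [hW, cutoff_eq_one hx]
  obtain ⟨ε₀, hε₀, hε⟩ : ∃ ε₀ : ℝ, 0 < ε₀ ∧ ε₀ * (2 * M) ≤ 1 / 2 := by
    refine ⟨1 / (4 * M + 1), by positivity, ?_⟩
    rw [div_mul_eq_mul_div, div_le_iff₀ (by positivity)]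
    linarith
  obtain ⟨H, hHs, hH⟩ := exists_smooth_inverse_family hWs hM0 hε₀ hε hM hM'
  set R := ε₀⁻¹ with hR
  have hR0 : 0 < R := inv_pos.2 hε₀
  -- `sin (π / 2) = 1` selects the perturbation of size exactly `ε₀`, which is the original equation
  -- rescaled by `ε₀ = R⁻¹`.
  set Φ : E → E := fun ξ => R • H (ε₀ • ξ, Real.pi / 2) with hΦ
  have hεR : ε₀ * R = 1 := mul_inv_cancel₀ hε₀.ne'
  have hRε : R * ε₀ = 1 := inv_mul_cancel₀ hε₀.ne'
  have hiff : ∀ x ξ, R < ‖x‖ → (x + V x = ξ ↔ x = Φ ξ) := by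
    intro x ξ hx
    have hnx : ‖ε₀ • x‖ = ε₀ * ‖x‖ := by rw [norm_smul, Real.norm_of_nonneg hε₀.le]
    have h1 : 1 / 4 ≤ ‖ε₀ • x‖ := by rw [hnx]; nlinarith
    have h2 := hH (ε₀ • x) (ε₀ • ξ) (Real.pi / 2)
    rw [Real.sin_pi_div_two, mul_one, hWV _ h1, hV.map_smul _ _ hε₀, ← smul_add,
      (smul_right_injective E hε₀.ne').eq_iff] at h2
    rw [h2, hΦ]
    constructor
    · intro h
      simp only [← h, smul_smul, hRε, one_smul]
    · intro h
      rw [h, smul_smul, hεR, one_smul]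
  have hinv : IsInverseOutside R V Φ := by
    refine ⟨hR0, ?_, hiff, ⟨M, fun ξ => ?_⟩, fun x hx => ?_⟩
    · exact (hHs.continuous.comp (by fun_prop : Continuous fun ξ : E =>
        (ε₀ • ξ, Real.pi / 2))).const_smul R
    · have h1 := (hH (H (ε₀ • ξ, Real.pi / 2)) (ε₀ • ξ) (Real.pi / 2)).2 rfl
      rw [Real.sin_pi_div_two, mul_one] at h1
      have h2 : Φ ξ - ξ = - W (H (ε₀ • ξ, Real.pi / 2)) := by
        have h3 : R • (ε₀ • ξ) = ξ := by rw [smul_smul, hRε, one_smul]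
        rw [← h1, smul_add, smul_smul, hRε, one_smul] at h3
        rw [sub_eq_iff_eq_add]
        nth_rw 3 [← h3]
        simp [hΦ]
      rw [h2, norm_neg]
      exact hM _
    · have h2 : V =ᶠ[𝓝 x] fun y => W (ε₀ • y) := by
        filter_upwards [continuous_norm.continuousAt.eventually (lt_mem_nhds hx)] with y hy
        have h1 : 1 / 4 ≤ ‖ε₀ • y‖ := by
          rw [norm_smul, Real.norm_of_nonneg hε₀.le]; nlinarith
        rw [hWV _ h1, hV.map_smul _ _ hε₀]
      rw [h2.fderiv_eq, fderiv_comp_smul, norm_smul, Real.norm_of_nonneg hε₀.le]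
      have := mul_le_mul_of_nonneg_left (hM' (ε₀ • x)) hε₀.le
      nlinarith
  refine ⟨R, Φ, hinv, fun G hG N C S => ?_⟩
  have hGc := contDiff_cutoff_smul hG.contDiffAt
  set Gc := fun x => cutoff x • G x with hGcdef
  have hLc : ContDiff ℝ ∞ (fun x : E => cutoff x • Real.log ‖x‖) :=
    contDiff_cutoff_smul fun x hx => (contDiffAt_norm ℝ hx).log (norm_ne_zero_iff.2 hx)
  set Lc := fun x : E => cutoff x • Real.log ‖x‖ with hLcdef
  set g : (E × ℝ) × ℂ → ℂ := fun p => Gc (H p.1) * Complex.exp (-p.2 * ((Lc (H p.1) : ℝ) : ℂ))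
    with hg
  have hgs : ContDiff ℝ ∞ g := by
    refine (hGc.comp (hHs.comp contDiff_fst)).mul ?_
    refine ContDiff.cexp (contDiff_snd.neg.mul ?_)
    exact Complex.ofRealCLM.contDiff.comp (hLc.comp (hHs.comp contDiff_fst))
  set D : Set ((E × ℝ) × ℂ) := (Metric.closedBall (0 : E) (1 + N * |C|) ×ˢ Icc 0 (Real.pi / 2)) ×ˢ
    Metric.closedBall (0 : ℂ) S with hD
  have hDc : IsCompact D := ((isCompact_closedBall _ _).prod isCompact_Icc).prod
    (isCompact_closedBall _ _)
  obtain ⟨A, hA⟩ := hDc.exists_bound_of_continuousOn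
    (hgs.continuous_iteratedFDeriv (m := N) (by exact_mod_cast le_top)).continuousOn
  -- This `r₀` ensures `r - M - N |C| ≥ r / 2 + R`. All points `ξ + k y`, `k ≤ N`, then have `‖z‖ ≥
  -- 1 / 4`, where the cutoffs equal 1, and `‖r z‖ > R`.
  refine ⟨|A| * |C| ^ N, max 1 (2 * R + 2 * (N * |C| + M)), by positivity, by positivity,
    fun ξ y s hξ hy hs => ?_⟩
  have hNC : 0 ≤ N * |C| := by positivity
  have hy' : ‖y‖ ≤ |C| := hy.trans (le_abs_self C)
  set r := ‖ξ‖ with hr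
  have hr1 : 1 ≤ r := (le_max_left _ _).trans hξ
  have hr2 : 2 * R + 2 * (N * |C| + M) ≤ r := (le_max_right _ _).trans hξ
  have hr0 : 0 < r := by linarith
  have hrR : 1 ≤ r * ε₀ := by nlinarith
  -- `τ` solves `ε₀ sin τ = r⁻¹`. It depends on `ξ` only and stays fixed along the points `ξ + k y`,
  -- so the step `h` below has zero `τ` component.
  set τ := Real.arcsin (r * ε₀)⁻¹ with hτ
  have hsin : ε₀ * Real.sin τ = r⁻¹ := by
    have h1 : 0 ≤ (r * ε₀)⁻¹ := by positivity
    rw [hτ, Real.sin_arcsin (by linarith) (inv_le_one_of_one_le₀ hrR), mul_inv, ← mul_assoc, mul_comm ε₀,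
      mul_assoc, mul_inv_cancel₀ hε₀.ne', mul_one]
  have hτ0 : 0 ≤ τ := Real.arcsin_nonneg.2 (by positivity)
  have hτ1 : τ ≤ Real.pi / 2 := Real.arcsin_le_pi_div_two _
  set p : (E × ℝ) × ℂ := ((r⁻¹ • ξ, τ), s) with hp
  set h : (E × ℝ) × ℂ := ((r⁻¹ • y, 0), 0) with hh
  have hhn : ‖h‖ ≤ |C| * r⁻¹ := by
    simp only [hh, Prod.norm_mk, norm_zero, norm_smul, norm_inv, Real.norm_of_nonneg hr0.le]
    rw [max_eq_left (by positivity), max_eq_left (by positivity), mul_comm]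
    gcongr
  have hval : ∀ k ∈ Finset.range (N + 1), symbolTerm R Φ G s (ξ + k • y) =
      Complex.exp (-s * Real.log r) * g (p + k • h) := by
    intro k hk
    have hkN : (k : ℝ) ≤ N := by exact_mod_cast Finset.mem_range_succ_iff.1 hk
    set z := H (r⁻¹ • (ξ + k • y), τ) with hz
    have hzeq := (hH z (r⁻¹ • (ξ + k • y)) τ).2 rfl
    rw [hsin] at hzeq
    have hpk : (p + k • h).1 = (r⁻¹ • (ξ + k • y), τ) := by
      simp [hp, hh, smul_add, smul_comm k]
    have hpk2 : (p + k • h).2 = s := by simp [hp, hh]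
    have hrz : r • z + W z = ξ + k • y := by
      have := congrArg (fun v => r • v) hzeq
      simpa [smul_add, smul_smul, mul_inv_cancel₀ hr0.ne'] using this
    have hky : ‖k • y‖ ≤ N * |C| := by
      rw [← Nat.cast_smul_eq_nsmul ℝ, norm_smul, Real.norm_natCast]
      gcongr
    have hrzn : r / 2 + R ≤ r * ‖z‖ := by
      have h1 : ‖ξ‖ ≤ ‖r • z‖ + ‖W z‖ + ‖k • y‖ := by
        calc ‖ξ‖ = ‖r • z + W z - k • y‖ := by rw [hrz, add_sub_cancel_right]
          _ ≤ _ := (norm_sub_le _ _).trans (add_le_add_left (norm_add_le _ _) _)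
      rw [norm_smul, Real.norm_of_nonneg hr0.le] at h1
      linarith [hM z]
    have hz4 : 1 / 4 ≤ ‖z‖ := by
      by_contra hcon
      push Not at hcon
      nlinarith
    have hnrz : ‖r • z‖ = r * ‖z‖ := by rw [norm_smul, Real.norm_of_nonneg hr0.le]
    have hlt : R < ‖r • z‖ := by rw [hnrz]; linarith
    have hΦz : r • z = Φ (ξ + k • y) := by
      rw [← hiff _ _ hlt, hV.map_smul _ _ hr0, ← hWV _ hz4, hrz]
    have hz0 : ‖z‖ ≠ 0 := by linarith
    rw [symbolTerm, ← hΦz, if_pos hlt, hG.map_smul _ _ hr0, hnrz, Real.log_mul hr0.ne' hz0]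
    simp only [hg, hpk, hpk2, ← hz, hGcdef, hLcdef, cutoff_eq_one hz4, one_smul]
    push_cast
    rw [mul_add, Complex.exp_add]
    ring
  have hsum : (fwdDiff y)^[N] (symbolTerm R Φ G s) ξ =
      Complex.exp (-s * Real.log r) * (fwdDiff h)^[N] g p := by
    simp only [fwdDiff_iter_eq_sum_shift, Finset.mul_sum]
    refine Finset.sum_congr rfl fun k hk => ?_
    rw [hval k hk, mul_smul_comm]
  have hfd := norm_iterate_fwdDiff_le hgs (N := N) (p := p) (h := h) (A := |A|) fun t ht => by
    refine (hA _ ⟨⟨?_, ?_⟩, ?_⟩).trans (le_abs_self A)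
    · simp only [hp, hh, Prod.smul_mk, Prod.mk_add_mk, Metric.mem_closedBall, dist_zero_right]
      refine (norm_add_le _ _).trans ?_
      have h1 : ‖r⁻¹ • ξ‖ = 1 := by
        rw [norm_smul, norm_inv, Real.norm_of_nonneg hr0.le, ← hr, inv_mul_cancel₀ hr0.ne']
      have h2 : ‖t • r⁻¹ • y‖ ≤ N * |C| := by
        rw [norm_smul, norm_smul, norm_inv, Real.norm_of_nonneg hr0.le, Real.norm_of_nonneg ht.1]
        have h3 : r⁻¹ ≤ 1 := inv_le_one_of_one_le₀ hr1
        have h4 : r⁻¹ * ‖y‖ ≤ 1 * |C| := by gcongr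
        rw [one_mul] at h4
        exact mul_le_mul ht.2 h4 (by positivity) (by positivity)
      rw [h1]; linarith
    · simp [hp, hh, hτ0, hτ1]
    · simpa [hp, hh] using hs
  have hexp : ‖Complex.exp (-s * Real.log r)‖ = r ^ (-s.re) := by
    rw [Complex.norm_exp, Real.rpow_def_of_pos hr0]
    congr 1
    simp
    ring
  rw [hsum, norm_mul, hexp]
  calc r ^ (-s.re) * ‖(fwdDiff h)^[N] g p‖ ≤ r ^ (-s.re) * (|A| * (|C| * r⁻¹) ^ N) := by
        gcongr
        exact hfd.trans (by gcongr)
    _ = |A| * |C| ^ N * r ^ (-s.re - N) := by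
        rw [Real.rpow_sub hr0, Real.rpow_natCast, mul_pow, inv_pow]
        ring

end Symbol

/-! ### Holomorphy of sums and integrals, and gluing -/

section Holomorphy

theorem differentiableOn_tsum_of_locally_bounded {ι : Type*} {u : ι → ℂ → ℂ} {U : Set ℂ}
    (hU : IsOpen U) (hd : ∀ n, DifferentiableOn ℂ (u n) U)
    (hb : ∀ s₀ ∈ U, ∃ V, IsOpen V ∧ s₀ ∈ V ∧ ∃ B : ι → ℝ, Summable B ∧
      ∀ n, ∀ s ∈ V ∩ U, ‖u n s‖ ≤ B n) :
    DifferentiableOn ℂ (fun s => ∑' n, u n s) U := by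
  intro s₀ hs₀
  obtain ⟨V, hV, hsV, B, hB, hle⟩ := hb s₀ hs₀
  have h1 := Complex.differentiableOn_tsum_of_summable_norm hB
    (fun n => (hd n).mono inter_subset_right) (hV.inter hU) (fun n s hs => hle n s hs)
  exact (h1.differentiableAt ((hV.inter hU).mem_nhds ⟨hsV, hs₀⟩)).differentiableWithinAt

/-- By Cauchy's estimate on unit circles, a bound on the values of `h` already dominates its
derivative in `s`. -/
theorem differentiable_integral_of_locally_bounded {α : Type*} [MeasurableSpace α] {μ : Measure α}
    [IsFiniteMeasure μ] {h : ℂ → α → ℂ} (hm : ∀ s, AEStronglyMeasurable (h s) μ)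
    (hd : ∀ a, Differentiable ℂ fun s => h s a)
    (hb : ∀ S : ℝ, ∃ C : ℝ, ∀ᵐ a ∂μ, ∀ s, ‖s‖ ≤ S → ‖h s a‖ ≤ C) :
    Differentiable ℂ fun s => ∫ a, h s a ∂μ := by
  intro s₀
  obtain ⟨C, hC⟩ := hb (‖s₀‖ + 2)
  have hint : Integrable (h s₀) μ := by
    refine Integrable.of_bound (hm s₀) C ?_
    filter_upwards [hC] with a ha using ha s₀ (by linarith)
  have hder : AEStronglyMeasurable (fun a => deriv (fun s => h s a) s₀) μ := by
    have ht : Tendsto (fun n : ℕ => (1 / ((n : ℂ) + 1))) atTop (𝓝[≠] 0) := by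
      refine tendsto_nhdsWithin_iff.2 ⟨tendsto_one_div_add_atTop_nhds_zero_nat, ?_⟩
      filter_upwards with n
      exact one_div_ne_zero (by exact_mod_cast Nat.succ_ne_zero n)
    refine aestronglyMeasurable_of_tendsto_ae (u := atTop) (f := fun (n : ℕ) a =>
      (1 / ((n : ℂ) + 1))⁻¹ • (h (s₀ + 1 / ((n : ℂ) + 1)) a - h s₀ a))
      (fun n => ((hm (s₀ + 1 / ((n : ℂ) + 1))).sub (hm s₀)).const_smul (1 / ((n : ℂ) + 1))⁻¹) ?_
    filter_upwards with a
    exact (((hd a) s₀).hasDerivAt.tendsto_slope_zero).comp ht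
  have := hasDerivAt_integral_of_dominated_loc_of_deriv_le (μ := μ) (F := h) (x₀ := s₀)
    (F' := fun s a => deriv (fun s => h s a) s) (bound := fun _ => C / 1)
    (s := Metric.ball s₀ 1) (Metric.ball_mem_nhds s₀ one_pos)
    (Eventually.of_forall hm) hint hder (by
      filter_upwards [hC] with a ha s hs
      refine Complex.norm_deriv_le_of_forall_mem_sphere_norm_le one_pos
        (hd a).diffContOnCl fun z hz => ha z ?_
      have h1 : ‖z - s‖ = 1 := by simpa [dist_eq_norm] using hz
      have h2 : ‖s - s₀‖ < 1 := by simpa [dist_eq_norm] using hs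
      have h3 : z = (z - s) + (s - s₀) + s₀ := by ring
      rw [h3]
      refine (norm_add_le _ _).trans ?_
      have := norm_add_le (z - s) (s - s₀)
      linarith)
    (integrable_const _) (by
      filter_upwards with a s _
      exact ((hd a) s).hasDerivAt)
  exact this.2.differentiableAt

theorem isOpen_halfPlane (a : ℝ) : IsOpen {s : ℂ | a < s.re} :=
  isOpen_lt continuous_const Complex.continuous_re

/-- Holomorphic extensions to larger and larger half-planes glue to an entire function. -/
theorem exists_differentiable_of_halfPlane {a : ℝ} {Z : ℂ → ℂ}
    (h : ∀ N : ℕ, ∃ f : ℂ → ℂ, DifferentiableOn ℂ f {s | a - N < s.re} ∧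
      ∀ s : ℂ, a < s.re → f s = Z s) :
    ∃ f : ℂ → ℂ, Differentiable ℂ f ∧ ∀ s : ℂ, a < s.re → f s = Z s := by
  choose f hf hfZ using h
  -- Identity theorem on the smaller of the two half-planes: both functions equal `Z` on `Re s > a`.
  have hagree : ∀ N M : ℕ, ∀ s : ℂ, a - N < s.re → a - M < s.re → f N s = f M s := by
    intro N M s hN hM
    set K := min N M
    have hKN : ∀ s : ℂ, a - K < s.re → a - N < s.re := fun s hs => by
      have : (K : ℝ) ≤ N := by exact_mod_cast min_le_left _ _
      linarith
    have hKM : ∀ s : ℂ, a - K < s.re → a - M < s.re := fun s hs => by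
      have : (K : ℝ) ≤ M := by exact_mod_cast min_le_right _ _
      linarith
    have hKs : a - K < s.re := by
      rcases min_choice N M with hk | hk <;> simp only [K, hk] <;> assumption
    have h1 : AnalyticOnNhd ℂ (f N) {s | a - K < s.re} :=
      ((hf N).mono hKN).analyticOnNhd (isOpen_halfPlane _)
    have h2 : AnalyticOnNhd ℂ (f M) {s | a - K < s.re} :=
      ((hf M).mono hKM).analyticOnNhd (isOpen_halfPlane _)
    have hpre : IsPreconnected {s : ℂ | a - K < s.re} :=
      (convex_halfSpace_re_gt _).isPreconnected
    have hK0 : (0 : ℝ) ≤ K := Nat.cast_nonneg K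
    refine h1.eqOn_of_preconnected_of_eventuallyEq h2 hpre (z₀ := ((a + 1 : ℝ) : ℂ))
      (by simp only [mem_ofPred_eq, Complex.ofReal_re]; linarith) ?_ hKs
    filter_upwards [(isOpen_halfPlane a).mem_nhds
      (by simp : ((a + 1 : ℝ) : ℂ) ∈ {s : ℂ | a < s.re})] with z hz
    rw [hfZ N z hz, hfZ M z hz]
  have hidx : ∀ s : ℂ, a - (⌈a - s.re⌉₊ + 1 : ℕ) < s.re := fun s => by
    have := Nat.le_ceil (a - s.re)
    push_cast
    linarith
  refine ⟨fun s => f (⌈a - s.re⌉₊ + 1) s, fun s₀ => ?_, fun s hs => hfZ _ s hs⟩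
  have h1 := (hf (⌈a - s₀.re⌉₊ + 1)).differentiableAt ((isOpen_halfPlane _).mem_nhds (hidx s₀))
  refine h1.congr_of_eventuallyEq ?_
  filter_upwards [(isOpen_halfPlane _).mem_nhds (hidx s₀)] with s hs
  exact hagree _ _ s (hidx s) hs

end Holomorphy

/-! ### Cells of the lattice -/

section Cells

variable {d : ℕ}

/-- The translate by `2πn` of the cube `[0, 2π)^d`. -/
def latticeCell (n : Fin d → ℤ) : Set (Euc d) := {x | ∀ i, ⌊x i / (2 * Real.pi)⌋ = n i}

theorem measurableSet_latticeCell (n : Fin d → ℤ) : MeasurableSet (latticeCell n) := by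
  have h : latticeCell n = ⋂ i, (fun x : Euc d => ⌊x i / (2 * Real.pi)⌋) ⁻¹' {n i} := by
    ext x; simp [latticeCell]
  rw [h]
  refine MeasurableSet.iInter fun i => ?_
  exact (Int.measurable_floor.comp (by fun_prop)) (measurableSet_singleton _)

theorem add_mem_latticeCell {n : Fin d → ℤ} {x : Euc d} :
    latticeVec n + x ∈ latticeCell n ↔ x ∈ latticeCell 0 := by
  refine forall_congr' fun i => ?_
  simp only [PiLp.add_apply, latticeVec_apply, Pi.zero_apply]
  rw [add_div, mul_div_cancel_left₀ _ (by positivity), Int.floor_intCast_add]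
  omega

theorem norm_le_of_mem_latticeCell {x : Euc d} (hx : x ∈ latticeCell 0) :
    ‖x‖ ≤ √(d * (2 * Real.pi) ^ 2) := by
  rw [EuclideanSpace.norm_eq]
  refine Real.sqrt_le_sqrt ?_
  calc ∑ i, ‖x i‖ ^ 2 ≤ ∑ _i : Fin d, (2 * Real.pi) ^ 2 := by
        refine Finset.sum_le_sum fun i _ => ?_
        have h := Int.floor_eq_iff.1 (hx i)
        simp only [Pi.zero_apply, Int.cast_zero, zero_add] at h
        have h1 : 0 ≤ x i := by
          have := (div_nonneg_iff.1 h.1)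
          rcases this with h2 | h2
          · exact h2.1
          · linarith [Real.pi_pos]
        have h2 := (div_lt_one (by positivity)).1 h.2
        rw [Real.norm_of_nonneg h1]
        gcongr
    _ = _ := by simp

theorem isBounded_latticeCell : Bornology.IsBounded (latticeCell (0 : Fin d → ℤ)) :=
  isBounded_iff_forall_norm_le.2 ⟨_, fun _ hx => norm_le_of_mem_latticeCell hx⟩

instance isFiniteMeasure_restrict_latticeCell :
    IsFiniteMeasure ((volume : Measure (Euc d)).restrict (latticeCell (0 : Fin d → ℤ))) :=
  ⟨by rw [Measure.restrict_apply_univ]; exact isBounded_latticeCell.measure_lt_top⟩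

theorem volume_real_latticeCell_pos :
    0 < (volume : Measure (Euc d)).real (latticeCell (0 : Fin d → ℤ)) := by
  refine ENNReal.toReal_pos ?_ isBounded_latticeCell.measure_lt_top.ne
  have hopen : IsOpen {x : Euc d | ∀ i, x i ∈ Ioo 0 (2 * Real.pi)} := by
    simp only [ofPred_forall]
    exact isOpen_iInter_of_finite fun i => isOpen_Ioo.preimage (by fun_prop)
  have hne : {x : Euc d | ∀ i, x i ∈ Ioo 0 (2 * Real.pi)}.Nonempty :=
    ⟨WithLp.toLp 2 fun _ => Real.pi, fun i => ⟨Real.pi_pos, by simp; linarith [Real.pi_pos]⟩⟩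
  refine ((hopen.measure_pos volume hne).trans_le (measure_mono ?_)).ne'
  intro x hx i
  rw [Pi.zero_apply, Int.floor_eq_iff]
  have h := hx i
  have hp : (0 : ℝ) < 2 * Real.pi := by positivity
  simp only [Int.cast_zero, zero_add]
  exact ⟨div_nonneg h.1.le hp.le, (div_lt_one hp).2 h.2⟩

variable {F : Type*} [NormedAddCommGroup F] [NormedSpace ℝ F]

theorem setIntegral_latticeCell (f : Euc d → F) (n : Fin d → ℤ) :
    ∫ x in latticeCell n, f x = ∫ y in latticeCell 0, f (latticeVec n + y) := by
  rw [← integral_indicator (measurableSet_latticeCell n),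
    ← integral_indicator (measurableSet_latticeCell 0), ← integral_add_left_eq_self _ (latticeVec n)]
  congr 1
  funext y
  by_cases hy : y ∈ latticeCell 0
  · rw [indicator_of_mem hy, indicator_of_mem (add_mem_latticeCell.2 hy)]
  · rw [indicator_of_notMem hy, indicator_of_notMem (mt add_mem_latticeCell.1 hy)]

/-- The integral over `ℝ^d` is the sum of the integrals over the cells. -/
theorem hasSum_integral_latticeCell {f : Euc d → F} (hf : Integrable f) :
    HasSum (fun n : Fin d → ℤ => ∫ y in latticeCell 0, f (latticeVec n + y)) (∫ x, f x) := by
  have h1 : ⋃ n : Fin d → ℤ, latticeCell n = univ := by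
    refine eq_univ_of_forall fun x => mem_iUnion.2 ⟨fun i => ⌊x i / (2 * Real.pi)⌋, fun i => rfl⟩
  have h2 : Pairwise (Function.onFun Disjoint (latticeCell (d := d))) := by
    intro n m hnm
    refine disjoint_left.2 fun x hx hx' => hnm (funext fun i => ?_)
    rw [← hx i, ← hx' i]
  have h3 := hasSum_integral_iUnion (fun n => measurableSet_latticeCell (d := d) n) h2
    (f := f) (μ := volume) hf.integrableOn
  rw [h1, setIntegral_univ] at h3
  exact h3.congr_fun fun n => (setIntegral_latticeCell f n).symm

/-- Decomposition of `ℤ^d` into residue classes modulo `m`. -/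
def divModPi (d m : ℕ) [NeZero m] : (Fin d → ℤ) ≃ (Fin d → ℤ) × (Fin d → Fin m) :=
  (Equiv.piCongrRight fun _ => Int.divModEquiv m).trans (Equiv.arrowProdEquivProdArrow _ _ _)

theorem divModPi_symm_apply (d m : ℕ) [NeZero m] (q : Fin d → ℤ) (r : Fin d → Fin m) (i : Fin d) :
    (divModPi d m).symm (q, r) i = r i + q i * m := by
  simp [divModPi, Equiv.arrowProdEquivProdArrow, Equiv.piCongrRight, Int.divModEquiv, add_comm]

/-- Split `n = r + m q` by residues modulo `m`. For fixed `r` the sum over `q` is `∫ f(2πr + m x) dx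
= m^{-d} ∫ f`, and there are `m^d` residues, so the total does not depend on `m`. -/
theorem hasSum_integral_latticeCell_dilate {f : Euc d → F} (hf : Integrable f) {m : ℕ}
    (hm : m ≠ 0) :
    HasSum (fun n : Fin d → ℤ => ∫ y in latticeCell 0, f (latticeVec n + m • y)) (∫ x, f x) := by
  have : NeZero m := ⟨hm⟩
  have hm0 : (m : ℝ) ≠ 0 := Nat.cast_ne_zero.2 hm
  set φ : (Fin d → ℤ) → F := fun n => ∫ y in latticeCell 0, f (latticeVec n + m • y) with hφ
  have hr : ∀ r : Fin d → Fin m,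
      HasSum (fun q : Fin d → ℤ => φ ((divModPi d m).symm (q, r))) (((m : ℝ) ^ d)⁻¹ • ∫ x, f x) := by
    intro r
    set v : Euc d := latticeVec fun i => ((r i : ℕ) : ℤ) with hv
    have h1 : Integrable fun x => f (v + (m : ℝ) • x) :=
      (hf.comp_add_left v).comp_smul hm0
    have h2 := hasSum_integral_latticeCell h1
    have h3 : ∫ x, f (v + (m : ℝ) • x) = ((m : ℝ) ^ d)⁻¹ • ∫ x, f x := by
      rw [Measure.integral_comp_smul volume (fun x => f (v + x)) (m : ℝ),
        integral_add_left_eq_self, finrank_euclideanSpace, Fintype.card_fin,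
        abs_of_nonneg (by positivity)]
    rw [h3] at h2
    convert h2 using 2 with q
    refine setIntegral_congr_fun (measurableSet_latticeCell 0) fun y _ => ?_
    congr 1
    ext i
    simp only [PiLp.add_apply, latticeVec_apply, divModPi_symm_apply, hv, PiLp.smul_apply,
      smul_eq_mul, nsmul_eq_mul]
    push_cast
    ring
  have hr' : ∀ r : Fin d → Fin m, HasSum
      (indicator (range fun q : Fin d → ℤ => (divModPi d m).symm (q, r)) φ)
      (((m : ℝ) ^ d)⁻¹ • ∫ x, f x) := by
    intro r
    have hinj : Function.Injective fun q : Fin d → ℤ => (divModPi d m).symm (q, r) :=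
      fun q q' h => congrArg Prod.fst ((divModPi d m).symm.injective h)
    rw [← hinj.hasSum_iff (fun n hn => indicator_of_notMem hn _)]
    convert hr r using 2 with q
    exact indicator_of_mem (mem_range_self q) φ
  have hsum := hasSum_sum (s := Finset.univ) fun r _ => hr' r
  have hval : ∑ _r : Fin d → Fin m, ((m : ℝ) ^ d)⁻¹ • ∫ x, f x = ∫ x, f x := by
    rw [Finset.sum_const, Finset.card_univ, Fintype.card_fun, Fintype.card_fin, Fintype.card_fin,
      ← Nat.cast_smul_eq_nsmul ℝ, smul_smul]
    push_cast
    rw [mul_inv_cancel₀ (pow_ne_zero _ hm0), one_smul]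
  rw [hval] at hsum
  convert hsum using 2 with n
  have hmem : ∀ r : Fin d → Fin m, n ∈ (range fun q : Fin d → ℤ => (divModPi d m).symm (q, r)) ↔
      r = (divModPi d m n).2 := by
    intro r
    constructor
    · rintro ⟨q, rfl⟩
      simp
    · rintro rfl
      exact ⟨(divModPi d m n).1, by simp⟩
  rw [Finset.sum_eq_single (divModPi d m n).2, indicator_of_mem ((hmem _).2 rfl)]
  · exact fun r _ hr => indicator_of_notMem (mt (hmem r).1 hr) _
  · simp

end Cells

/-! ### Lattice sums of symbols -/

section LatticeSums

variable {d : ℕ}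

/-- A family of symbols of order `-s` on `ℝ^d`, depending holomorphically on `s`. The estimates are
expressed through finite differences. -/
structure IsSymbolFamily (F : ℂ → Euc d → ℂ) : Prop where
  differentiable : ∀ ξ, Differentiable ℂ fun s => F s ξ
  measurable : ∀ s, Measurable (F s)
  estimate : ∀ (N : ℕ) (C S : ℝ), ∃ A : ℝ, 0 ≤ A ∧ ∀ (ξ y : Euc d) (s : ℂ), ‖y‖ ≤ C → ‖s‖ ≤ S →
    ‖(fwdDiff y)^[N] (F s) ξ‖ ≤ A * (1 + ‖ξ‖) ^ (-s.re - N)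

theorem integrable_one_add_norm_rpow {σ : ℝ} (hσ : d < σ) :
    Integrable fun x : Euc d => (1 + ‖x‖) ^ (-σ) :=
  integrable_one_add_norm (by simpa using hσ)

/-- Comparison with the integral: on the cell at `2πn` the integrand is at least a constant multiple
of its value at `2πn`, since `1 + ‖2πn + y‖ ≤ (1 + D)(1 + ‖2πn‖)`. -/
theorem summable_one_add_norm_latticeVec {σ : ℝ} (hσ : d < σ) :
    Summable fun n : Fin d → ℤ => (1 + ‖latticeVec n‖) ^ (-σ) := by
  have hσ0 : 0 < σ := lt_of_le_of_lt (Nat.cast_nonneg d) hσ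
  set D := √(d * (2 * Real.pi) ^ 2) with hD
  have hD0 : 0 ≤ D := Real.sqrt_nonneg _
  set v := (volume : Measure (Euc d)).real (latticeCell (0 : Fin d → ℤ)) with hv
  have hv0 : 0 < v := volume_real_latticeCell_pos
  have hint := integrable_one_add_norm_rpow hσ
  have hsum := (hasSum_integral_latticeCell hint).summable
  have hle : ∀ n : Fin d → ℤ, v * (1 + D) ^ (-σ) * (1 + ‖latticeVec n‖) ^ (-σ) ≤
      ∫ y in latticeCell 0, (1 + ‖latticeVec n + y‖) ^ (-σ) := by
    intro n
    have h1 : ∫ _y in latticeCell (0 : Fin d → ℤ), (1 + D) ^ (-σ) * (1 + ‖latticeVec n‖) ^ (-σ) =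
        v * (1 + D) ^ (-σ) * (1 + ‖latticeVec n‖) ^ (-σ) := by
      rw [setIntegral_const, smul_eq_mul, mul_assoc]
    rw [← h1]
    refine setIntegral_mono_on (integrable_const _) (hint.comp_add_left _).integrableOn
      (measurableSet_latticeCell 0) fun y hy => ?_
    rw [← Real.mul_rpow (by positivity) (by positivity)]
    refine Real.rpow_le_rpow_of_nonpos (by positivity) ?_ (by linarith)
    have h2 := norm_le_of_mem_latticeCell hy
    have h3 := norm_add_le (latticeVec n) y
    nlinarith [mul_nonneg hD0 (norm_nonneg (latticeVec n))]
  have h4 : Summable fun n : Fin d → ℤ => v * (1 + D) ^ (-σ) * (1 + ‖latticeVec n‖) ^ (-σ) :=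
    Summable.of_nonneg_of_le (fun n => by positivity) hle hsum
  exact (summable_mul_left_iff (by positivity)).1 h4

/-- This is where `N` extra orders of decay become `N` extra units of half-plane: near `s₀`, choose
`σ` with `d - N < σ < Re s₀` and majorize by the exponent `-(σ + N) < -d`. -/
theorem differentiableOn_tsum_lattice {u : (Fin d → ℤ) → ℂ → ℂ} {N : ℕ}
    (hu : ∀ n, Differentiable ℂ (u n))
    (hb : ∀ S : ℝ, ∃ A : ℝ, 0 ≤ A ∧ ∀ n s, ‖s‖ ≤ S →
      ‖u n s‖ ≤ A * (1 + ‖latticeVec n‖) ^ (-s.re - N)) :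
    DifferentiableOn ℂ (fun s => ∑' n, u n s) {s | d - N < s.re} := by
  refine differentiableOn_tsum_of_locally_bounded (isOpen_halfPlane _)
    (fun n => (hu n).differentiableOn) fun s₀ hs₀ => ?_
  obtain ⟨A, hA, hle⟩ := hb (‖s₀‖ + 1)
  obtain ⟨σ, hσ1, hσ2⟩ := exists_between (show (d : ℝ) - N < s₀.re from hs₀)
  refine ⟨Metric.ball s₀ 1 ∩ {s | σ < s.re}, Metric.isOpen_ball.inter (isOpen_halfPlane σ),
    ⟨Metric.mem_ball_self one_pos, hσ2⟩, fun n => A * (1 + ‖latticeVec n‖) ^ (-(σ + N)),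
    (summable_one_add_norm_latticeVec (by linarith)).mul_left A, fun n s hs => ?_⟩
  have h1 : ‖s‖ ≤ ‖s₀‖ + 1 := by
    have h2 : ‖s - s₀‖ < 1 := by simpa [dist_eq_norm] using hs.1.1
    have := norm_add_le (s - s₀) s₀
    rw [sub_add_cancel] at this
    linarith
  have h3 : σ < s.re := hs.1.2
  refine (hle n s h1).trans ?_
  simp only
  gcongr
  · linarith [norm_nonneg (latticeVec n)]
  · linarith

theorem IsSymbolFamily.norm_le {F : ℂ → Euc d → ℂ} (hF : IsSymbolFamily F) (S : ℝ) :
    ∃ A : ℝ, 0 ≤ A ∧ ∀ (ξ : Euc d) (s : ℂ), ‖s‖ ≤ S → ‖F s ξ‖ ≤ A * (1 + ‖ξ‖) ^ (-s.re) := by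
  obtain ⟨A, hA, hle⟩ := hF.estimate 0 0 S
  exact ⟨A, hA, fun ξ s hs => by simpa using hle ξ 0 s (by simp) hs⟩

theorem IsSymbolFamily.summable {F : ℂ → Euc d → ℂ} (hF : IsSymbolFamily F) {s : ℂ}
    (hs : d < s.re) : Summable fun n : Fin d → ℤ => ‖F s (latticeVec n)‖ := by
  obtain ⟨A, hA, hle⟩ := hF.norm_le ‖s‖
  exact Summable.of_nonneg_of_le (fun n => norm_nonneg _) (fun n => hle _ s le_rfl)
    ((summable_one_add_norm_latticeVec hs).mul_left A)

theorem IsSymbolFamily.integrable {F : ℂ → Euc d → ℂ} (hF : IsSymbolFamily F) {s : ℂ}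
    (hs : d < s.re) : Integrable (F s) := by
  obtain ⟨A, hA, hle⟩ := hF.norm_le ‖s‖
  exact ((integrable_one_add_norm_rpow hs).const_mul A).mono' (hF.measurable s).aestronglyMeasurable
    (Eventually.of_forall fun ξ => hle ξ s le_rfl)

theorem IsSymbolFamily.differentiable_fwdDiff {F : ℂ → Euc d → ℂ} (hF : IsSymbolFamily F) (N : ℕ)
    (y ξ : Euc d) : Differentiable ℂ fun s => (fwdDiff y)^[N] (F s) ξ := by
  simp only [fwdDiff_iter_eq_sum_shift]
  refine Differentiable.fun_sum fun k _ => ?_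
  simp only [zsmul_eq_mul]
  exact (hF.differentiable _).const_mul _

/-- Summation by parts: reindexing by `n ↦ n + m` shows that a shift of `f` by `2πm` multiplies the
twisted sum by `(e m)⁻¹`. -/
theorem hasSum_mul_iterate_fwdDiff {e : (Fin d → ℤ) → ℂ} (he : ∀ n m, e (n + m) = e n * e m)
    (he0 : ∀ n, e n ≠ 0) (m : Fin d → ℤ) {f : Euc d → ℂ} {z : ℂ}
    (hf : HasSum (fun n => e n * f (latticeVec n)) z) (N : ℕ) :
    HasSum (fun n => e n * (fwdDiff (latticeVec m))^[N] f (latticeVec n))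
      (((e m)⁻¹ - 1) ^ N * z) := by
  induction N with
  | zero => simpa using hf
  | succ N ih =>
    set g := (fwdDiff (latticeVec m))^[N] f with hg
    have h1 : HasSum (fun n => e n * g (latticeVec n + latticeVec m))
        ((e m)⁻¹ * (((e m)⁻¹ - 1) ^ N * z)) := by
      have h2 := ((Equiv.addRight m).hasSum_iff.2 ih).mul_left (e m)⁻¹
      refine h2.congr_fun fun n => ?_
      simp only [Function.comp_apply, Equiv.coe_addRight, he, latticeVec_add]
      rw [mul_comm (e n) (e m), ← mul_assoc, ← mul_assoc, inv_mul_cancel₀ (he0 m), one_mul]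
    have h3 := h1.sub ih
    rw [Function.iterate_succ_apply', ← hg]
    have hz : (e m)⁻¹ * (((e m)⁻¹ - 1) ^ N * z) - ((e m)⁻¹ - 1) ^ N * z =
        ((e m)⁻¹ - 1) ^ (N + 1) * z := by ring
    rw [hz] at h3
    refine h3.congr_fun fun n => ?_
    simp only [fwdDiff]
    ring

/-- The lattice sum of a symbol twisted by a nontrivial character extends to an entire function. -/
theorem IsSymbolFamily.exists_entire_of_character_ne_one {F : ℂ → Euc d → ℂ}
    (hF : IsSymbolFamily F) {e : (Fin d → ℤ) → ℂ} (he : ∀ n m, e (n + m) = e n * e m)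
    (he1 : ∀ n, ‖e n‖ = 1) {m : Fin d → ℤ} (hm : e m ≠ 1) :
    ∃ f : ℂ → ℂ, Differentiable ℂ f ∧ ∀ s : ℂ, d < s.re →
      HasSum (fun n => e n * F s (latticeVec n)) (f s) := by
  have he0 : ∀ n, e n ≠ 0 := fun n h => by simpa [h] using he1 n
  have hsum : ∀ s : ℂ, d < s.re → HasSum (fun n => e n * F s (latticeVec n))
      (∑' n, e n * F s (latticeVec n)) := fun s hs =>
    (Summable.of_norm (by simpa [he1] using hF.summable hs)).hasSum
  set c := (e m)⁻¹ - 1 with hc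
  have hc0 : c ≠ 0 := by
    rw [hc, sub_ne_zero]
    exact fun h => hm (inv_eq_one.1 h)
  obtain ⟨f, hf, hfZ⟩ := exists_differentiable_of_halfPlane (a := d)
    (Z := fun s => ∑' n, e n * F s (latticeVec n)) fun N => by
      -- Dividing by `c ^ N` recovers the original sum for `Re s > d`, and the differenced series
      -- converges for `Re s > d - N`.
      refine ⟨fun s => (c ^ N)⁻¹ * ∑' n, e n * (fwdDiff (latticeVec m))^[N] (F s) (latticeVec n),
        DifferentiableOn.const_mul (differentiableOn_tsum_lattice
          (fun n => (hF.differentiable_fwdDiff N _ _).const_mul _) fun S => ?_) _, fun s hs => ?_⟩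
      · obtain ⟨A, hA, hle⟩ := hF.estimate N ‖latticeVec m‖ S
        refine ⟨A, hA, fun n s hs => ?_⟩
        rw [norm_mul, he1, one_mul]
        exact hle _ _ s le_rfl hs
      · simp only
        rw [(hasSum_mul_iterate_fwdDiff he he0 m (hsum s hs) N).tsum_eq, ← mul_assoc,
          inv_mul_cancel₀ (pow_ne_zero _ hc0), one_mul]
  exact ⟨f, hf, fun s hs => by rw [hfZ s hs]; exact hsum s hs⟩

/-- The difference between the lattice sum and the integral of a symbol extends to an entire
function. -/
theorem IsSymbolFamily.exists_entire_sub_integral {F : ℂ → Euc d → ℂ} (hF : IsSymbolFamily F) :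
    ∃ (f : ℂ → ℂ) (c : ℂ), Differentiable ℂ f ∧ ∀ s : ℂ, d < s.re →
      HasSum (fun n => F s (latticeVec n)) (f s + c * ∫ x, F s x) := by
  set v := (volume : Measure (Euc d)).real (latticeCell (0 : Fin d → ℤ)) with hv
  have hv0 : (v : ℂ) ≠ 0 := Complex.ofReal_ne_zero.2 volume_real_latticeCell_pos.ne'
  have hsum : ∀ s : ℂ, d < s.re → HasSum (fun n => F s (latticeVec n))
      (∑' n, F s (latticeVec n)) := fun s hs => (Summable.of_norm (hF.summable hs)).hasSum
  have hmeas : ∀ (s : ℂ) (ξ : Euc d) (k : ℕ), Measurable fun y => F s (ξ + k • y) := fun s ξ k =>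
    (hF.measurable s).comp (by fun_prop)
  have hmeas' : ∀ (N : ℕ) (s : ℂ) (ξ : Euc d), Measurable fun y => (fwdDiff y)^[N] (F s) ξ := by
    intro N s ξ
    simp only [fwdDiff_iter_eq_sum_shift, zsmul_eq_mul]
    exact Finset.measurable_fun_sum _ fun k _ => (hmeas s ξ k).const_mul _
  set D := √(d * (2 * Real.pi) ^ 2) with hD
  obtain ⟨f, hf, hfZ⟩ := exists_differentiable_of_halfPlane (a := d)
    (Z := fun s => ∑' n, F s (latticeVec n) - (v : ℂ)⁻¹ * ∫ x, F s x) fun N => by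
      -- Expanding the difference, `k = 0` gives `(-1)^(N+1) v ∑ F` and each `k ≥ 1` gives its
      -- binomial coefficient times `∫ F`. The coefficients sum to zero, so the total is `(-1)^(N+1)
      -- (v ∑ F - ∫ F)`; the prefactor normalizes it.
      refine ⟨fun s => ((-1) ^ (N + 1) * (v : ℂ)⁻¹) *
        ∑' n, ∫ y in latticeCell 0, (fwdDiff y)^[N + 1] (F s) (latticeVec n), ?_, fun s hs => ?_⟩
      · refine (DifferentiableOn.const_mul (differentiableOn_tsum_lattice (N := N + 1) (fun n => ?_)
          fun S => ?_) _).mono fun s hs => ?_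
        · refine differentiable_integral_of_locally_bounded
            (fun s => (hmeas' _ s _).aestronglyMeasurable)
            (fun y => hF.differentiable_fwdDiff _ _ _) fun S => ?_
          obtain ⟨A, hA, hle⟩ := hF.estimate (N + 1) D S
          refine ⟨A * (1 + ‖latticeVec n‖) ^ S, ?_⟩
          filter_upwards [ae_restrict_mem (measurableSet_latticeCell 0)] with y hy s hs
          refine (hle _ y s (norm_le_of_mem_latticeCell hy) hs).trans ?_
          gcongr
          · linarith [norm_nonneg (latticeVec n)]
          · have h1 := Complex.abs_re_le_norm s
            have h2 := neg_abs_le s.re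
            have h3 : (0 : ℝ) ≤ (N + 1 : ℕ) := Nat.cast_nonneg _
            linarith
        · obtain ⟨A, hA, hle⟩ := hF.estimate (N + 1) D S
          have hvpos : 0 < v := volume_real_latticeCell_pos
          refine ⟨A * v, by positivity, fun n s hs => ?_⟩
          refine (norm_setIntegral_le_of_norm_le_const isBounded_latticeCell.measure_lt_top
            fun y hy => hle _ y s (norm_le_of_mem_latticeCell hy) hs).trans (le_of_eq ?_)
          ring
        · have hs' : (d : ℝ) - N < s.re := hs
          simp only [mem_ofPred_eq]
          push_cast
          linarith
      · have hint := hF.integrable hs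
        have hk : ∀ k : ℕ, HasSum (fun n : Fin d → ℤ =>
            ∫ y in latticeCell 0, F s (latticeVec n + k • y))
            (if k = 0 then v * ∑' n, F s (latticeVec n) else ∫ x, F s x) := by
          intro k
          split_ifs with h
          · subst h
            simpa [setIntegral_const] using (hsum s hs).mul_left (v : ℂ)
          · exact hasSum_integral_latticeCell_dilate hint h
        have hkint : ∀ (n : Fin d → ℤ) (k : ℕ), IntegrableOn (fun y => F s (latticeVec n + k • y))
            (latticeCell 0) := by
          intro n k
          obtain ⟨A, hA, hle⟩ := hF.norm_le ‖s‖
          refine Integrable.of_bound (hmeas s _ k).aestronglyMeasurable A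
            (Eventually.of_forall fun y => (hle _ s le_rfl).trans ?_)
          refine mul_le_of_le_one_right hA (Real.rpow_le_one_of_one_le_of_nonpos ?_ ?_)
          · linarith [norm_nonneg (latticeVec n + k • y)]
          · have : (0 : ℝ) ≤ d := Nat.cast_nonneg d
            linarith
        have htot := hasSum_sum (s := Finset.range (N + 1 + 1)) fun k _ =>
          (hk k).mul_left ((((-1 : ℤ) ^ (N + 1 - k) * (N + 1).choose k : ℤ)) : ℂ)
        have hfun : (fun n : Fin d → ℤ => ∑ k ∈ Finset.range (N + 1 + 1),
            ((((-1 : ℤ) ^ (N + 1 - k) * (N + 1).choose k : ℤ)) : ℂ) *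
              ∫ y in latticeCell 0, F s (latticeVec n + k • y)) =
            fun n => ∫ y in latticeCell 0, (fwdDiff y)^[N + 1] (F s) (latticeVec n) := by
          funext n
          simp only [fwdDiff_iter_eq_sum_shift, zsmul_eq_mul]
          rw [integral_finsetSum _ fun k _ => (hkint n k).const_mul _]
          exact Finset.sum_congr rfl fun k _ => (integral_const_mul _ _).symm
        rw [hfun] at htot
        simp only
        rw [htot.tsum_eq]
        -- `(1 - 1)^(N+1) = 0` needs a positive exponent, hence differences of order `N + 1` rather
        -- than `N`.
        have hbin : ∑ k ∈ Finset.range (N + 1 + 1),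
            ((((-1 : ℤ) ^ (N + 1 - k) * (N + 1).choose k : ℤ)) : ℂ) = 0 := by
          have h1 := add_pow (1 : ℂ) (-1) (N + 1)
          rw [add_neg_cancel, zero_pow (Nat.succ_ne_zero N)] at h1
          rw [h1]
          exact Finset.sum_congr rfl fun k _ => by push_cast; ring
        rw [Finset.sum_range_succ'] at hbin ⊢
        simp only [Nat.succ_ne_zero, if_false, if_true]
        rw [← Finset.sum_mul, eq_neg_of_add_eq_zero_left hbin]
        simp only [Nat.sub_zero, Nat.choose_zero_right]
        push_cast
        have hsq : ((-1 : ℂ) ^ (N + 1)) * (-1) ^ (N + 1) = 1 := by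
          rw [← mul_pow]; simp
        field_simp
        linear_combination (v * ∑' n, F s (latticeVec n) - ∫ x, F s x) * hsq
  refine ⟨f, (v : ℂ)⁻¹, hf, fun s hs => ?_⟩
  rw [hfZ s hs, sub_add_cancel]
  exact hsum s hs

end LatticeSums

/-! ### Symbols attached to homogeneous functions -/

section SymbolFamily

theorem exists_bound_of_continuousOn_of_homogeneous {E F : Type*} [NormedAddCommGroup E]
    [NormedSpace ℝ E] [FiniteDimensional ℝ E] [NormedAddCommGroup F] {a : E → F}
    (ha : ContinuousOn a {0}ᶜ) (hh : ∀ (r : ℝ) (x : E), 0 < r → a (r • x) = a x) :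
    ∃ B : ℝ, 0 ≤ B ∧ ∀ x, x ≠ 0 → ‖a x‖ ≤ B := by
  obtain ⟨B, hB⟩ := (isCompact_sphere (0 : E) 1).exists_bound_of_continuousOn
    (ha.mono fun x hx => by
      rw [mem_compl_singleton_iff]
      rintro rfl
      simp at hx)
  refine ⟨|B|, abs_nonneg B, fun x hx => ?_⟩
  have hn : ‖‖x‖⁻¹ • x‖ = 1 := by
    rw [norm_smul, norm_inv, norm_norm, inv_mul_cancel₀ (norm_ne_zero_iff.2 hx)]
  rw [← hh ‖x‖⁻¹ x (inv_pos.2 (norm_pos_iff.2 hx))]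
  exact (hB _ (by simpa using hn)).trans (le_abs_self B)

theorem IsSmoothHomogeneous.continuousOn {E F : Type*} [NormedAddCommGroup E]
    [InnerProductSpace ℝ E] [NormedAddCommGroup F] [NormedSpace ℝ F] {V : E → F}
    (hV : IsSmoothHomogeneous V) : ContinuousOn V {0}ᶜ := fun x hx =>
  (hV.contDiffAt x hx).continuousAt.continuousWithinAt

theorem norm_iterate_fwdDiff_le_of_norm_le {E : Type*} [AddCommGroup E] {f : E → ℂ} {ξ y : E}
    {N : ℕ} {B : ℝ} (hB : ∀ k ≤ N, ‖f (ξ + k • y)‖ ≤ B) :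
    ‖(fwdDiff y)^[N] f ξ‖ ≤
      (∑ k ∈ Finset.range (N + 1), ‖(((-1 : ℤ) ^ (N - k) * N.choose k : ℤ) : ℂ)‖) * B := by
  rw [fwdDiff_iter_eq_sum_shift, Finset.sum_mul]
  refine (norm_sum_le _ _).trans (Finset.sum_le_sum fun k hk => ?_)
  rw [zsmul_eq_mul, norm_mul]
  gcongr
  exact hB k (Finset.mem_range_succ_iff.1 hk)

theorem rpow_le_mul_one_add_rpow {r₀ r a b : ℝ} (hr₀ : 0 < r₀) (hr : r₀ ≤ r) (ha : |a| ≤ b) :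
    r ^ a ≤ ((1 + r₀) / r₀) ^ b * (1 + r) ^ a := by
  have hr0 : 0 < r := hr₀.trans_le hr
  have h1 : r = ((1 + r) / r)⁻¹ * (1 + r) := by field_simp
  have hq : 1 ≤ (1 + r) / r := by rw [le_div_iff₀ hr0]; linarith
  have hq' : (1 + r) / r ≤ (1 + r₀) / r₀ := by
    rw [div_le_div_iff₀ hr0 hr₀]; nlinarith
  nth_rw 1 [h1]
  rw [Real.mul_rpow (by positivity) (by positivity), Real.inv_rpow (by positivity),
    ← Real.rpow_neg (by positivity)]
  gcongr
  calc ((1 + r) / r) ^ (-a) ≤ ((1 + r) / r) ^ b :=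
        Real.rpow_le_rpow_of_exponent_le hq ((neg_le_abs a).trans ha)
    _ ≤ _ := Real.rpow_le_rpow (by positivity) hq' ((abs_nonneg a).trans ha)

/-- For `‖ξ‖ ≥ r₀` only the passage from `‖ξ‖` to `1 + ‖ξ‖` is needed. For `‖ξ‖ < r₀` a nonzero term
has `R < ‖Φ(ξ + k y)‖ ≤ T`, so differences are bounded trivially, and the weight `(1 + ‖ξ‖)^{-Re s -
N}` is bounded below. -/
theorem isSymbolFamily_symbolTerm {d : ℕ} {R : ℝ} {V Φ : Euc d → Euc d} {G : Euc d → ℂ}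
    (hΦ : IsInverseOutside R V Φ) (hG : IsSmoothHomogeneous G) (hest : SymbolEstimate R Φ G) :
    IsSymbolFamily (symbolTerm R Φ G) := by
  have hGm : Measurable G := measurable_of_continuousOn_compl_singleton 0 hG.continuousOn
  refine ⟨fun ξ => ?_, fun s => ?_, fun N C S => ?_⟩
  · simp only [symbolTerm]
    split_ifs
    · fun_prop
    · fun_prop
  · have hm := hΦ.continuous.measurable
    exact Measurable.ite (measurableSet_lt measurable_const hm.norm)
      ((hGm.comp hm).mul (by fun_prop)) measurable_const
  obtain ⟨A, r₀, hr₀, hA, hle⟩ := hest N C S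
  obtain ⟨B, hB0, hB⟩ := exists_bound_of_continuousOn_of_homogeneous hG.continuousOn hG.map_smul
  obtain ⟨M, hM⟩ := hΦ.exists_bound
  set T := r₀ + N * |C| + M with hT
  set L := max |Real.log R| |Real.log T| with hL
  set B' := B * Real.exp (|S| * L) with hB'
  set A₂ := (∑ k ∈ Finset.range (N + 1), ‖(((-1 : ℤ) ^ (N - k) * N.choose k : ℤ) : ℂ)‖) * B' with hA₂
  have hA₂0 : 0 ≤ A₂ := by positivity
  set b := |S| + N with hb
  have hb0 : 0 ≤ b := by positivity
  refine ⟨A * ((1 + r₀) / r₀) ^ b + A₂ * (1 + r₀) ^ b, by positivity, fun ξ y s hy hs => ?_⟩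
  have hab : |-s.re - N| ≤ b := by
    have h1 := Complex.abs_re_le_norm s
    have h2 := le_abs_self S
    have h3 : |-s.re - (N : ℝ)| ≤ |s.re| + N := by
      rw [← abs_neg, neg_sub, sub_neg_eq_add]
      exact (abs_add_le _ _).trans (by rw [Nat.abs_cast, add_comm])
    linarith
  have hpos : 0 < (1 + ‖ξ‖) ^ (-s.re - N) := by positivity
  rcases le_or_gt r₀ ‖ξ‖ with hξ | hξ
  · have h1 := hle ξ y s hξ hy hs
    have h2 := rpow_le_mul_one_add_rpow hr₀ hξ hab
    have h3 := mul_le_mul_of_nonneg_left h2 hA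
    have h4 : 0 ≤ A₂ * (1 + r₀) ^ b * (1 + ‖ξ‖) ^ (-s.re - N) := by positivity
    nlinarith
  · have h1 : ∀ k ≤ N, ‖symbolTerm R Φ G s (ξ + k • y)‖ ≤ B' := by
      intro k hk
      rw [symbolTerm]
      split_ifs with hlt
      · have hR := hΦ.pos
        set t := ‖Φ (ξ + k • y)‖ with ht
        have hne : Φ (ξ + k • y) ≠ 0 := norm_pos_iff.1 (hR.trans hlt)
        have hkN : (k : ℝ) ≤ N := by exact_mod_cast hk
        have hky : ‖k • y‖ ≤ N * |C| := by
          rw [← Nat.cast_smul_eq_nsmul ℝ, norm_smul, Real.norm_natCast]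
          exact mul_le_mul hkN (hy.trans (le_abs_self C)) (norm_nonneg _) (Nat.cast_nonneg _)
        have htT : t ≤ T := by
          have h2 := hM (ξ + k • y)
          have h3 := norm_le_norm_add_norm_sub' (Φ (ξ + k • y)) (ξ + k • y)
          have h4 := norm_add_le ξ (k • y)
          linarith
        have hlog : |Real.log t| ≤ L :=
          abs_le_max_abs_abs (Real.log_le_log hR hlt.le) (Real.log_le_log (hR.trans hlt) htT)
        rw [norm_mul, Complex.norm_exp]
        refine mul_le_mul (hB _ hne) (Real.exp_le_exp.2 ?_) (Real.exp_pos _).le hB0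
        refine (Complex.re_le_norm _).trans ?_
        rw [norm_mul, norm_neg, Complex.norm_real]
        exact mul_le_mul (hs.trans (le_abs_self S)) hlog (norm_nonneg _) (abs_nonneg S)
      · rw [norm_zero]; positivity
    refine (norm_iterate_fwdDiff_le_of_norm_le h1).trans ?_
    have h2 : 1 ≤ (1 + r₀) ^ b * (1 + ‖ξ‖) ^ (-s.re - N) := by
      have h3 : (1 + ‖ξ‖) ^ (-b) ≤ (1 + ‖ξ‖) ^ (-s.re - N) :=
        Real.rpow_le_rpow_of_exponent_le (by linarith [norm_nonneg ξ])
          (by linarith [neg_le_abs (-s.re - (N : ℝ))])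
      have h4 : (1 + ‖ξ‖) ^ b ≤ (1 + r₀) ^ b :=
        Real.rpow_le_rpow (by positivity) (by linarith) hb0
      calc (1 : ℝ) = (1 + ‖ξ‖) ^ b * (1 + ‖ξ‖) ^ (-b) := by
            rw [← Real.rpow_add (by positivity), add_neg_cancel, Real.rpow_zero]
        _ ≤ _ := by gcongr
    have h5 := mul_le_mul_of_nonneg_left h2 hA₂0
    have h6 : 0 ≤ A * ((1 + r₀) / r₀) ^ b * (1 + ‖ξ‖) ^ (-s.re - N) := by positivity
    nlinarith

end SymbolFamily

/-! ### Integrals of homogeneous functions in polar coordinates -/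

section Polar

variable {d : ℕ}

/-- Integration in polar coordinates separates a homogeneous factor from a radial one. -/
theorem exists_integral_mul_radial [Nontrivial (Euc d)] {a : Euc d → ℂ}
    (hh : ∀ (r : ℝ) (x : Euc d), 0 < r → a (r • x) = a x) :
    ∃ C : ℂ, ∀ w : ℝ → ℂ, ∫ x, a x * w ‖x‖ = C * ∫ y in Ioi (0 : ℝ), y ^ (d - 1) • w y := by
  set μ := (volume : Measure (Euc d))
  have key : ∀ b : Euc d → ℂ, (∀ (r : ℝ) (x : Euc d), 0 < r → b (r • x) = b x) → ∀ w : ℝ → ℂ,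
      ∫ x, b x * w ‖x‖ ∂μ = (∫ θ, b (θ : Euc d) ∂μ.toSphere) *
        ∫ y : Ioi (0 : ℝ), w y ∂(.volumeIoiPow (Module.finrank ℝ (Euc d) - 1)) := by
    intro b hb w
    calc ∫ x, b x * w ‖x‖ ∂μ
        = ∫ x : ({(0)}ᶜ : Set (Euc d)), b x.1 * w ‖x.1‖ ∂(μ.comap (↑)) := by
          rw [integral_subtype_comap (measurableSet_singleton _).compl fun x => b x * w ‖x‖,
            restrict_compl_singleton]
      _ = ∫ p : Metric.sphere (0 : Euc d) 1 × Ioi (0 : ℝ), b p.1.1 * w p.2.1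
            ∂μ.toSphere.prod (.volumeIoiPow (Module.finrank ℝ (Euc d) - 1)) := by
          rw [← μ.measurePreserving_homeomorphUnitSphereProd.integral_comp
            (Homeomorph.measurableEmbedding _)
            (fun p : Metric.sphere (0 : Euc d) 1 × Ioi (0 : ℝ) => b p.1.1 * w p.2.1)]
          congr 1
          funext x
          have hx : 0 < ‖x.1‖ := norm_pos_iff.2 x.2
          simp only [homeomorphUnitSphereProd_apply_snd_coe, homeomorphUnitSphereProd_apply_fst_coe]
          rw [hb _ _ (inv_pos.2 hx)]
      _ = _ := integral_prod_mul (fun θ : Metric.sphere (0 : Euc d) 1 => b θ.1)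
          (fun y : Ioi (0 : ℝ) => w y.1)
  have hS : ((μ.toSphere.real univ : ℝ) : ℂ) ≠ 0 := by
    refine Complex.ofReal_ne_zero.2 (ENNReal.toReal_pos ?_ (measure_ne_top _ _)).ne'
    exact (Measure.measure_univ_ne_zero).2 (Measure.toSphere_ne_zero μ)
  refine ⟨(∫ θ, a (θ : Euc d) ∂μ.toSphere) * ((μ.toSphere.real univ : ℝ) : ℂ)⁻¹ *
    (d * (μ.real (Metric.ball 0 1) : ℝ)), fun w => ?_⟩
  -- The constant function 1 calibrates the radial measure: comparison with the known formula for
  -- radial integrals expresses it through `y ^ (d - 1) dy`, after division by the area of the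
  -- sphere.
  have h1 := key (fun _ => 1) (fun _ _ _ => rfl) w
  have h2 := key a hh w
  have h3 := integral_fun_norm_addHaar μ w
  simp only [one_mul, integral_const, finrank_euclideanSpace, Fintype.card_fin] at h1 h2 h3
  rw [h3] at h1
  rw [h2, mul_assoc, mul_assoc]
  congr 1
  rw [eq_inv_mul_iff_mul_eq₀ hS]
  simp only [Complex.real_smul, nsmul_eq_mul, mul_one] at h1 ⊢
  rw [← h1]
  ring

theorem exp_neg_mul_log_eq_cpow {r : ℝ} (hr : 0 < r) (s : ℂ) :
    Complex.exp (-s * Real.log r) = (r : ℂ) ^ (-s) := by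
  rw [Complex.cpow_def_of_ne_zero (Complex.ofReal_ne_zero.2 hr.ne'), Complex.ofReal_log hr.le,
    mul_comm]

theorem integrableOn_homogeneous_mul_exp {a : Euc d → ℂ} (ha : ContinuousOn a {0}ᶜ)
    (hh : ∀ (r : ℝ) (x : Euc d), 0 < r → a (r • x) = a x) {R : ℝ} (hR : 0 < R) {s : ℂ}
    (hs : d < s.re) :
    IntegrableOn (fun x => a x * Complex.exp (-s * Real.log ‖x‖)) {x | R < ‖x‖} := by
  obtain ⟨B, hB0, hB⟩ := exists_bound_of_continuousOn_of_homogeneous ha hh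
  have ham : Measurable a := measurable_of_continuousOn_compl_singleton 0 ha
  have hint := (integrable_one_add_norm_rpow hs).const_mul (B * ((1 + R) / R) ^ |s.re|)
  refine Integrable.mono' hint.integrableOn
    (ham.mul (by fun_prop)).aestronglyMeasurable ?_
  filter_upwards [ae_restrict_mem (measurableSet_lt measurable_const measurable_norm)] with x hx
  have hx0 : 0 < ‖x‖ := hR.trans hx
  rw [norm_mul, exp_neg_mul_log_eq_cpow hx0, Complex.norm_cpow_eq_rpow_re_of_pos hx0, mul_assoc]
  refine mul_le_mul (hB x (norm_pos_iff.1 hx0)) ?_ (by positivity) hB0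
  exact rpow_le_mul_one_add_rpow hR (le_of_lt hx) (by simp)

/-- The integral of a homogeneous function outside a ball. -/
theorem exists_integral_homogeneous_mul_exp [Nontrivial (Euc d)] {a : Euc d → ℂ}
    (hh : ∀ (r : ℝ) (x : Euc d), 0 < r → a (r • x) = a x) {R : ℝ} (hR : 0 < R) :
    ∃ C : ℂ, ∀ s : ℂ, d < s.re → ∫ x in {x | R < ‖x‖}, a x * Complex.exp (-s * Real.log ‖x‖) =
      C * ((R : ℂ) ^ ((d : ℂ) - s) / (s - d)) := by
  have hd : 1 ≤ d := by
    by_contra hcon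
    have : d = 0 := by omega
    subst this
    exact not_subsingleton (Euc 0) inferInstance
  obtain ⟨C, hC⟩ := exists_integral_mul_radial hh
  refine ⟨C, fun s hs => ?_⟩
  have h1 := hC ((Ioi R).indicator fun r => Complex.exp (-s * Real.log r))
  have hSm : MeasurableSet {x : Euc d | R < ‖x‖} := measurableSet_lt measurable_const measurable_norm
  rw [← integral_indicator hSm]
  have h2 : ({x : Euc d | R < ‖x‖}.indicator fun x => a x * Complex.exp (-s * Real.log ‖x‖)) =
      fun x => a x * (Ioi R).indicator (fun r => Complex.exp (-s * Real.log r)) ‖x‖ := by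
    funext x
    by_cases hx : R < ‖x‖
    · rw [indicator_of_mem (show x ∈ {x : Euc d | R < ‖x‖} from hx),
        indicator_of_mem (show ‖x‖ ∈ Ioi R from hx)]
    · rw [indicator_of_notMem (show x ∉ {x : Euc d | R < ‖x‖} from hx),
        indicator_of_notMem (show ‖x‖ ∉ Ioi R from hx), mul_zero]
  rw [h2, h1]
  congr 1
  have h3 : (fun y : ℝ => y ^ (d - 1) • (Ioi R).indicator (fun r => Complex.exp (-s * Real.log r)) y) =
      (Ioi R).indicator fun y : ℝ => (y : ℂ) ^ ((d : ℂ) - s - 1) := by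
    funext y
    by_cases hy : R < y
    · have hy0 : 0 < y := hR.trans hy
      have hyc : (y : ℂ) ≠ 0 := Complex.ofReal_ne_zero.2 hy0.ne'
      rw [indicator_of_mem (show y ∈ Ioi R from hy), indicator_of_mem (show y ∈ Ioi R from hy),
        exp_neg_mul_log_eq_cpow hy0, Complex.real_smul, Complex.ofReal_pow, ← Complex.cpow_natCast,
        ← Complex.cpow_add _ _ hyc, Nat.cast_sub hd]
      congr 1
      push_cast
      ring
    · rw [indicator_of_notMem (show y ∉ Ioi R from hy), indicator_of_notMem (show y ∉ Ioi R from hy),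
        smul_zero]
  rw [h3, setIntegral_indicator measurableSet_Ioi, Ioi_inter_Ioi, max_eq_right hR.le,
    integral_Ioi_cpow_of_lt (by simp; linarith) hR, sub_add_cancel, ← neg_sub s, div_neg, neg_div,
    neg_neg]

end Polar

/-! ### The Jacobian determinant -/

section Jacobian

variable {d : ℕ}

/-- Along the segment from the identity the determinant never vanishes, so it keeps the sign of `det
1`. -/
theorem det_id_add_pos {A : Euc d →L[ℝ] Euc d} (hA : ‖A‖ ≤ 1 / 2) :
    0 < (ContinuousLinearMap.id ℝ (Euc d) + A).det := by
  set f : ℝ → ℝ := fun t => (ContinuousLinearMap.id ℝ (Euc d) + t • A).det with hf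
  have hfc : Continuous f := ContinuousLinearMap.continuous_det.comp (by fun_prop)
  have h0 : f 0 = 1 := by
    have h : ContinuousLinearMap.id ℝ (Euc d) + (0 : ℝ) • A = ContinuousLinearMap.id ℝ (Euc d) := by
      ext v; simp
    simp only [hf, h]
    exact LinearMap.det_id (M := Euc d)
  have hne : ∀ t ∈ Icc (0 : ℝ) 1, f t ≠ 0 := by
    intro t ht h
    have h1 := LinearMap.bot_lt_ker_of_det_eq_zero h
    obtain ⟨u, hu, hu0⟩ := Submodule.exists_mem_ne_zero_of_ne_bot h1.ne'
    have h2 : u + t • A u = 0 := hu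
    have h3 : ‖u‖ = ‖t • A u‖ := by
      conv_lhs => rw [eq_neg_of_add_eq_zero_left h2, norm_neg]
    rw [norm_smul, Real.norm_of_nonneg ht.1] at h3
    have h4 := A.le_of_opNorm_le hA u
    have h5 : 0 < ‖u‖ := norm_pos_iff.2 hu0
    nlinarith [ht.2, norm_nonneg (A u)]
  have h1 : f 1 = (ContinuousLinearMap.id ℝ (Euc d) + A).det := by simp [hf]
  rw [← h1]
  by_contra hcon
  push Not at hcon
  obtain ⟨t, ht, ht0⟩ := intermediate_value_Icc' zero_le_one hfc.continuousOn
    (show (0 : ℝ) ∈ Icc (f 1) (f 0) from ⟨hcon, by rw [h0]; norm_num⟩)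
  exact hne t ht ht0

/-- The coefficients of the polynomial `t ↦ det (1 + t A)`, for `A` singular, obtained by
interpolation. -/
noncomputable def detCoeff (d k : ℕ) (A : Euc d →L[ℝ] Euc d) : ℝ :=
  ∑ j ∈ Finset.range d, (ContinuousLinearMap.id ℝ (Euc d) + (j : ℝ) • A).det *
    (Lagrange.basis (Finset.range d) (fun j : ℕ => (j : ℝ)) j).coeff k

theorem continuous_detCoeff (k : ℕ) : Continuous (detCoeff d k) := by
  refine continuous_finsetSum _ fun j _ => Continuous.mul ?_ continuous_const
  exact ContinuousLinearMap.continuous_det.comp (by fun_prop)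

/-- The coefficient of `t^d` is `det A = 0`, so the polynomial has degree below `d` and is recovered
from its values at `0, …, d - 1`. The missing top coefficient is why no pole occurs at `s = 0`;
interpolation makes the coefficients visibly continuous in `A`. -/
theorem det_id_add_smul {A : Euc d →L[ℝ] Euc d} {x : Euc d} (hx : x ≠ 0) (hA : A x = 0) (t : ℝ) :
    (ContinuousLinearMap.id ℝ (Euc d) + t • A).det =
      ∑ k ∈ Finset.range d, detCoeff d k A * t ^ k := by
  have hd : 0 < d := by
    rcases Nat.eq_zero_or_pos d with rfl | h
    · exact absurd (Subsingleton.elim x 0) hx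
    · exact h
  set b := (EuclideanSpace.basisFun (Fin d) ℝ).toBasis
  set M := LinearMap.toMatrix b b (A : Euc d →ₗ[ℝ] Euc d) with hM
  set p : Polynomial ℝ := Matrix.det ((Polynomial.X : Polynomial ℝ) • M.map Polynomial.C +
    (1 : Matrix (Fin d) (Fin d) ℝ).map Polynomial.C) with hp
  have hev : ∀ t : ℝ, p.eval t = (ContinuousLinearMap.id ℝ (Euc d) + t • A).det := by
    intro t
    have h1 : (ContinuousLinearMap.id ℝ (Euc d) + t • A).det = Matrix.det (1 + t • M) := by
      rw [ContinuousLinearMap.det, ← LinearMap.det_toMatrix b]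
      congr 1
      rw [hM, ← map_smul, ← LinearMap.toMatrix_id b, ← map_add]
      rfl
    rw [h1, hp, ← Polynomial.coe_evalRingHom, RingHom.map_det]
    congr 1
    ext i j
    simp [Matrix.one_apply, add_comm, apply_ite]
    ring
  have hdetA : M.det = 0 := by
    rw [hM, LinearMap.det_toMatrix]
    by_contra hne
    exact hx ((LinearMap.equivOfDetNeZero _ hne).map_eq_zero_iff.1 hA)
  have hdeg : p.degree < (Finset.range d).card := by
    rw [Finset.card_range, Polynomial.degree_lt_iff_coeff_zero]
    intro m hm
    rcases hm.eq_or_lt with rfl | hm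
    · have := Polynomial.coeff_det_X_add_C_card M 1
      rw [Fintype.card_fin] at this
      rw [hp, this, hdetA]
    · refine Polynomial.coeff_eq_zero_of_natDegree_lt (lt_of_le_of_lt
        (Polynomial.natDegree_det_X_add_C_le M 1) ?_)
      simpa using hm
  have hinj : Set.InjOn (fun j : ℕ => (j : ℝ)) (Finset.range d : Set ℕ) := fun i _ j _ h => by
    exact Nat.cast_injective h
  have hint := Lagrange.eq_interpolate hinj hdeg
  have hnat : p.natDegree < d := by
    rcases eq_or_ne p 0 with h | h
    · rw [h]; simpa using hd
    · rw [Finset.card_range] at hdeg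
      exact (Polynomial.natDegree_lt_iff_degree_lt h).2 hdeg
  rw [← hev t, Polynomial.eval_eq_sum_range' hnat]
  refine Finset.sum_congr rfl fun k _ => ?_
  congr 1
  conv_lhs => rw [hint]
  rw [Lagrange.interpolate_apply, Polynomial.finsetSum_coeff, detCoeff]
  refine Finset.sum_congr rfl fun j _ => ?_
  rw [Polynomial.coeff_C_mul, hev]

end Jacobian

/-! ### The integral of the symbol -/

section SymbolIntegral

variable {d : ℕ}

theorem IsSmoothHomogeneous.fderiv_smul {V : Euc d → Euc d} (hV : IsSmoothHomogeneous V) {r : ℝ}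
    (hr : 0 < r) (x : Euc d) : r • fderiv ℝ V (r • x) = fderiv ℝ V x := by
  rw [← fderiv_comp_smul]
  congr 1
  funext y
  exact hV.map_smul r y hr

theorem IsSmoothHomogeneous.fderiv_apply_self {V : Euc d → Euc d} (hV : IsSmoothHomogeneous V)
    {x : Euc d} (hx : x ≠ 0) : fderiv ℝ V x x = 0 := by
  have h1 : HasFDerivAt V (fderiv ℝ V x) ((1 : ℝ) • x) := by
    rw [one_smul]
    exact ((hV.contDiffAt x hx).differentiableAt (by simp)).hasFDerivAt
  have h2 : HasDerivAt (fun t : ℝ => t • x) x 1 := by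
    simpa using (hasDerivAt_id (1 : ℝ)).smul_const x
  have h3 := h1.comp_hasDerivAt (1 : ℝ) h2
  have h4 : HasDerivAt (V ∘ fun t : ℝ => t • x) 0 1 := by
    refine (hasDerivAt_const (1 : ℝ) (V x)).congr_of_eventuallyEq ?_
    filter_upwards [lt_mem_nhds (zero_lt_one' ℝ)] with t ht
    exact hV.map_smul t x ht
  exact h3.unique h4

theorem IsInverseOutside.image_eq {R : ℝ} {V Φ : Euc d → Euc d} (hΦ : IsInverseOutside R V Φ) :
    (fun x => x + V x) '' {x | R < ‖x‖} = {ξ | R < ‖Φ ξ‖} := by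
  ext ξ
  constructor
  · rintro ⟨x, hx, rfl⟩
    have h := (hΦ.eq_iff x _ hx).1 rfl
    simp only [mem_ofPred_eq] at hx ⊢
    rwa [← h]
  · intro hξ
    exact ⟨Φ ξ, hξ, (hΦ.eq_iff _ ξ hξ).2 rfl⟩

theorem IsInverseOutside.injOn {R : ℝ} {V Φ : Euc d → Euc d} (hΦ : IsInverseOutside R V Φ) :
    InjOn (fun x => x + V x) {x | R < ‖x‖} := fun x hx y hy h => by
  rw [(hΦ.eq_iff x _ hx).1 rfl, (hΦ.eq_iff y _ hy).1 rfl]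
  exact congrArg Φ h

/-- The integral of a symbol is a sum of simple fractions in `s`. -/
theorem exists_integral_symbolTerm [Nontrivial (Euc d)] {R : ℝ} {V Φ : Euc d → Euc d}
    {G : Euc d → ℂ} (hV : IsSmoothHomogeneous V) (hΦ : IsInverseOutside R V Φ)
    (hG : IsSmoothHomogeneous G) :
    ∃ c : ℕ → ℂ, ∀ s : ℂ, d < s.re → ∫ ξ, symbolTerm R Φ G s ξ =
      ∑ k ∈ Finset.range d, c k * ((R : ℂ) ^ ((d : ℂ) - (s + k)) / (s + k - d)) := by
  have hR := hΦ.pos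
  have hSm : MeasurableSet {x : Euc d | R < ‖x‖} := measurableSet_lt measurable_const measurable_norm
  -- `DV` has degree `-1`, so `‖x‖ • DV(x)` has degree 0. Taking `t = ‖x‖⁻¹` in the determinant
  -- expansion leaves coefficients of degree 0 times `‖x‖^{-k}`, which shifts `s` to `s + k`.
  set a : ℕ → Euc d → ℂ := fun k x => G x * (detCoeff d k (‖x‖ • fderiv ℝ V x) : ℝ) with ha
  have hah : ∀ k (r : ℝ) (x : Euc d), 0 < r → a k (r • x) = a k x := by
    intro k r x hr
    simp only [ha, hG.map_smul r x hr, norm_smul, Real.norm_of_nonneg hr.le]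
    rw [mul_comm r, mul_smul, hV.fderiv_smul hr]
  have hac : ∀ k, ContinuousOn (a k) {0}ᶜ := by
    intro k x hx
    have h1 : ContinuousAt (fderiv ℝ V) x :=
      ((hV.contDiffAt x hx).fderiv_right (m := 0) (by simp)).continuousAt
    have h2 : ContinuousAt (fun x => ‖x‖ • fderiv ℝ V x) x := continuous_norm.continuousAt.smul h1
    have h3 : ContinuousAt (fun x => detCoeff d k (‖x‖ • fderiv ℝ V x)) x :=
      (continuous_detCoeff k).continuousAt.comp h2
    exact ((hG.contDiffAt x hx).continuousAt.mul
      (Complex.continuous_ofReal.continuousAt.comp h3)).continuousWithinAt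
  choose c hc using fun k => exists_integral_homogeneous_mul_exp (hah k) hR
  refine ⟨c, fun s hs => ?_⟩
  have hsk : ∀ k : ℕ, (d : ℝ) < (s + k).re := fun k => by
    have : (0 : ℝ) ≤ k := Nat.cast_nonneg k
    simp only [Complex.add_re, Complex.natCast_re]
    linarith
  have h1 : ∫ ξ, symbolTerm R Φ G s ξ = ∫ ξ in (fun x => x + V x) '' {x | R < ‖x‖},
      G (Φ ξ) * Complex.exp (-s * Real.log ‖Φ ξ‖) := by
    rw [hΦ.image_eq, ← integral_indicator
      (measurableSet_lt measurable_const hΦ.continuous.measurable.norm)]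
    rfl
  have hderiv : ∀ x ∈ {x : Euc d | R < ‖x‖}, HasFDerivWithinAt (fun x => x + V x)
      (ContinuousLinearMap.id ℝ (Euc d) + fderiv ℝ V x) {x | R < ‖x‖} x := fun x hx => by
    have hx0 : x ≠ 0 := norm_pos_iff.1 (hR.trans hx)
    exact ((hasFDerivAt_id x).add
      ((hV.contDiffAt x hx0).differentiableAt (by simp)).hasFDerivAt).hasFDerivWithinAt
  rw [h1, integral_image_eq_integral_abs_det_fderiv_smul volume hSm hderiv hΦ.injOn]
  have h2 : ∫ x in {x : Euc d | R < ‖x‖},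
      |(ContinuousLinearMap.id ℝ (Euc d) + fderiv ℝ V x).det| •
        (G (Φ (x + V x)) * Complex.exp (-s * Real.log ‖Φ (x + V x)‖)) =
      ∫ x in {x : Euc d | R < ‖x‖},
        ∑ k ∈ Finset.range d, a k x * Complex.exp (-(s + k) * Real.log ‖x‖) := by
    refine setIntegral_congr_fun hSm fun x hx => ?_
    have hx0 : 0 < ‖x‖ := hR.trans hx
    have hxc : (‖x‖ : ℂ) ≠ 0 := Complex.ofReal_ne_zero.2 hx0.ne'
    rw [← (hΦ.eq_iff x _ hx).1 rfl, abs_of_pos (det_id_add_pos (hΦ.norm_fderiv_le x hx))]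
    have hdet : (ContinuousLinearMap.id ℝ (Euc d) + fderiv ℝ V x).det =
        ∑ k ∈ Finset.range d, detCoeff d k (‖x‖ • fderiv ℝ V x) * (‖x‖⁻¹) ^ k := by
      rw [← det_id_add_smul (norm_pos_iff.1 hx0)
        (show (‖x‖ • fderiv ℝ V x) x = 0 by
          rw [smul_apply, hV.fderiv_apply_self (norm_pos_iff.1 hx0), smul_zero]),
        smul_smul, inv_mul_cancel₀ hx0.ne', one_smul]
    rw [hdet, Complex.real_smul, Complex.ofReal_sum, Finset.sum_mul]
    refine Finset.sum_congr rfl fun k _ => ?_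
    have hexp : Complex.exp (-(s + k) * Real.log ‖x‖) =
        ((‖x‖ : ℂ)⁻¹) ^ k * Complex.exp (-s * Real.log ‖x‖) := by
      rw [exp_neg_mul_log_eq_cpow hx0, exp_neg_mul_log_eq_cpow hx0, neg_add,
        Complex.cpow_add _ _ hxc, Complex.cpow_neg _ (k : ℂ), Complex.cpow_natCast, inv_pow, mul_comm]
    rw [hexp]
    simp only [ha]
    push_cast
    ring
  rw [h2, integral_finsetSum _ fun k _ =>
    integrableOn_homogeneous_mul_exp (hac k) (hah k) hR (hsk k)]
  exact Finset.sum_congr rfl fun k _ => hc k (s + k) (hsk k)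

end SymbolIntegral

/-! ### Orthogeodesics and lattice points -/

section Orthogeodesics

variable {d : ℕ} {K K₁ K₂ : Set (Euc d)}

/-- Changing the orientation precomposes the inverse Gauss map with the antipodal map. -/
theorem IsStrictlyConvexSmooth.exists_orientedGaussInverse (hK : IsStrictlyConvexSmooth K)
    (σ : ℤˣ) : ∃ Y : Euc d → Euc d, IsSmoothHomogeneous Y ∧
      ∀ x θ : Euc d, ‖θ‖ = 1 → ((x, θ) ∈ orientedNormalBundle σ K ↔ x = Y θ) := by
  obtain ⟨X, hXs, hXh, hX⟩ := hK.exists_gaussInverse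
  have hne : ∀ x : Euc d, x ≠ 0 → σ • x ≠ 0 := fun x hx => by
    rcases Int.units_eq_one_or σ with rfl | rfl <;> simpa using hx
  have hnorm : ∀ x : Euc d, ‖σ • x‖ = ‖x‖ := fun x => by
    rcases Int.units_eq_one_or σ with rfl | rfl <;> simp
  have hsm : ContDiff ℝ ∞ fun x : Euc d => σ • x := by
    rcases Int.units_eq_one_or σ with rfl | rfl
    · simpa using contDiff_fun_id
    · simpa using contDiff_neg
  refine ⟨fun x => X (σ • x), ⟨fun x hx => (hXs _ (hne x hx)).comp x hsm.contDiffAt,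
    fun r x hr => ?_⟩, fun x θ hθ => ?_⟩
  · rw [smul_comm, hXh r _ hr]
  · exact hX x (σ • θ) (by rw [hnorm, hθ])

theorem mem_torusNormalBundle_iff {σ : ℤˣ} {Y : Euc d → Euc d}
    (hY : ∀ x θ : Euc d, ‖θ‖ = 1 → ((x, θ) ∈ orientedNormalBundle σ K ↔ x = Y θ))
    {p : FlatTorus d} {θ : Euc d} (hθ : ‖θ‖ = 1) :
    (p, θ) ∈ torusNormalBundle σ K ↔ p = torusProj (Y θ) := by
  constructor
  · rintro ⟨⟨x, η⟩, hx, h⟩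
    obtain ⟨rfl, rfl⟩ := Prod.mk_inj.1 h
    rw [(hY x η hθ).1 hx]
  · rintro rfl
    exact ⟨(Y θ, θ), (hY _ θ hθ).2 rfl, rfl⟩

theorem torusProj_zero : torusProj (0 : Euc d) = 0 := by
  funext i; simp [torusProj]

theorem GeodesicArc.norm_length_smul_dir (γ : GeodesicArc d) : ‖γ.length • γ.dir‖ = γ.length := by
  rw [norm_smul, γ.norm_dir, mul_one, Real.norm_of_nonneg γ.length_pos.le]

/-- Orthogeodesics correspond to the vectors `x = ℓ θ` such that `x + Y₁(x) - Y₂(x)` lies in the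
lattice. -/
theorem mem_orthogeodesics_iff {σ₁ σ₂ : ℤˣ} {Y₁ Y₂ : Euc d → Euc d}
    (hY₁h : IsSmoothHomogeneous Y₁) (hY₂h : IsSmoothHomogeneous Y₂)
    (hY₁ : ∀ x θ : Euc d, ‖θ‖ = 1 → ((x, θ) ∈ orientedNormalBundle σ₁ K₁ ↔ x = Y₁ θ))
    (hY₂ : ∀ x θ : Euc d, ‖θ‖ = 1 → ((x, θ) ∈ orientedNormalBundle σ₂ K₂ ↔ x = Y₂ θ))
    (γ : GeodesicArc d) : γ ∈ orthogeodesics σ₁ σ₂ K₁ K₂ ↔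
      γ.start = torusProj (Y₁ (γ.length • γ.dir)) ∧ ∃ n : Fin d → ℤ, γ.length • γ.dir +
        (Y₁ (γ.length • γ.dir) - Y₂ (γ.length • γ.dir)) = latticeVec n := by
  rw [orthogeodesics, mem_ofPred_eq, mem_torusNormalBundle_iff hY₁ γ.norm_dir,
    mem_torusNormalBundle_iff hY₂ γ.norm_dir, hY₁h.map_smul _ _ γ.length_pos,
    hY₂h.map_smul _ _ γ.length_pos]
  have h0 : γ.point 0 = γ.start := by
    rw [GeodesicArc.point, zero_smul, torusProj_zero, add_zero]
  rw [h0]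
  refine and_congr_right fun hs => ?_
  rw [GeodesicArc.point_eq hs, torusProj_eq_iff]
  refine exists_congr fun n => ?_
  rw [← add_sub_assoc, sub_eq_iff_eq_add, add_comm (γ.length • γ.dir), add_comm (latticeVec n)]

/-- The long orthogeodesics are parametrized by lattice points. -/
theorem exists_equiv_longOrthogeodesics {σ₁ σ₂ : ℤˣ} {Y₁ Y₂ : Euc d → Euc d}
    (hY₁h : IsSmoothHomogeneous Y₁) (hY₂h : IsSmoothHomogeneous Y₂)
    (hY₁ : ∀ x θ : Euc d, ‖θ‖ = 1 → ((x, θ) ∈ orientedNormalBundle σ₁ K₁ ↔ x = Y₁ θ))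
    (hY₂ : ∀ x θ : Euc d, ‖θ‖ = 1 → ((x, θ) ∈ orientedNormalBundle σ₂ K₂ ↔ x = Y₂ θ))
    {R : ℝ} {Φ : Euc d → Euc d} (hΦ : IsInverseOutside R (fun x => Y₁ x - Y₂ x) Φ) :
    ∃ e : {n : Fin d → ℤ | R < ‖Φ (latticeVec n)‖} ≃ longOrthogeodesics σ₁ σ₂ K₁ K₂ R,
      ∀ n, (e n).1.length • (e n).1.dir = Φ (latticeVec n) ∧
        (e n).1.start = torusProj (Y₁ (Φ (latticeVec n))) := by
  have hpos : ∀ n : {n : Fin d → ℤ | R < ‖Φ (latticeVec n)‖}, 0 < ‖Φ (latticeVec n.1)‖ :=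
    fun n => hΦ.pos.trans n.2
  let g : {n : Fin d → ℤ | R < ‖Φ (latticeVec n)‖} → GeodesicArc d := fun n =>
    { start := torusProj (Y₁ (Φ (latticeVec n)))
      dir := ‖Φ (latticeVec n.1)‖⁻¹ • Φ (latticeVec n)
      length := ‖Φ (latticeVec n.1)‖
      norm_dir := norm_inv_norm_smul (norm_pos_iff.1 (hpos n))
      length_pos := hpos n }
  have hg : ∀ n, (g n).length • (g n).dir = Φ (latticeVec n) := fun n => by
    simp only [g]
    rw [smul_smul, mul_inv_cancel₀ (hpos n).ne', one_smul]
  have hmem : ∀ n, g n ∈ longOrthogeodesics σ₁ σ₂ K₁ K₂ R := by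
    intro n
    refine ⟨(mem_orthogeodesics_iff hY₁h hY₂h hY₁ hY₂ _).2 ⟨by rw [hg], n, ?_⟩, n.2⟩
    rw [hg]
    exact (hΦ.eq_iff _ _ n.2).2 rfl
  refine ⟨Equiv.ofBijective (fun n => ⟨g n, hmem n⟩) ⟨fun n m h => ?_, fun γ => ?_⟩,
    fun n => ⟨hg n, rfl⟩⟩
  · have h1 : g n = g m := congrArg Subtype.val h
    have h2 : Φ (latticeVec n) = Φ (latticeVec m) := by rw [← hg n, ← hg m, h1]
    have h3 := (hΦ.eq_iff _ _ n.2).2 rfl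
    rw [h2, (hΦ.eq_iff _ _ m.2).2 rfl] at h3
    refine Subtype.ext (funext fun i => ?_)
    have h4 := congrArg (fun v : Euc d => v i) h3
    simp only [latticeVec_apply] at h4
    have h5 := mul_left_cancel₀ (by positivity) h4
    exact_mod_cast h5.symm
  · obtain ⟨hs, n, hn⟩ := (mem_orthogeodesics_iff hY₁h hY₂h hY₁ hY₂ _).1 γ.2.1
    have hlt : R < ‖γ.1.length • γ.1.dir‖ := by
      rw [γ.1.norm_length_smul_dir]; exact γ.2.2
    have hx := (hΦ.eq_iff _ _ hlt).1 hn
    refine ⟨⟨n, by rw [mem_ofPred_eq, ← hx]; exact hlt⟩, Subtype.ext ?_⟩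
    have hl : ‖Φ (latticeVec n)‖ = γ.1.length := by rw [← hx, γ.1.norm_length_smul_dir]
    refine GeodesicArc.ext ?_ ?_ hl
    · simp only [g]
      rw [← hx, hs]
    · simp only [g]
      rw [hl, ← hx, smul_smul, inv_mul_cancel₀ γ.1.length_pos.ne', one_smul]

theorem finite_norm_latticeVec_le (T : ℝ) : {n : Fin d → ℤ | ‖latticeVec n‖ ≤ T}.Finite := by
  refine (Set.finite_Icc (fun _ : Fin d => -⌈T⌉) (fun _ => ⌈T⌉)).subset fun n hn => ?_
  have h : ∀ i, |(n i : ℝ)| ≤ ⌈T⌉ := fun i => by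
    have h1 : ‖latticeVec n i‖ ≤ ‖latticeVec n‖ := PiLp.norm_apply_le _ i
    have h2 : ‖latticeVec n i‖ = 2 * Real.pi * |(n i : ℝ)| := by
      rw [latticeVec_apply, Real.norm_eq_abs, abs_mul, abs_of_pos (by positivity)]
    have h3 : 1 ≤ 2 * Real.pi := by linarith [Real.pi_gt_three]
    have h4 : |(n i : ℝ)| ≤ 2 * Real.pi * |(n i : ℝ)| := le_mul_of_one_le_left (abs_nonneg _) h3
    have hn' : ‖latticeVec n‖ ≤ T := hn
    linarith [Int.le_ceil T]
  refine ⟨fun i => ?_, fun i => ?_⟩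
  · exact_mod_cast (abs_le.1 (h i)).1
  · exact_mod_cast (abs_le.1 (h i)).2

/-- `Φ` stays within `M` of the identity, so length at most `T` forces `‖2πn‖ ≤ T + M`. -/
theorem isLengthThreshold_of_isInverseOutside {σ₁ σ₂ : ℤˣ} {R : ℝ} {V Φ : Euc d → Euc d}
    (hΦ : IsInverseOutside R V Φ)
    (e : {n : Fin d → ℤ | R < ‖Φ (latticeVec n)‖} ≃ longOrthogeodesics σ₁ σ₂ K₁ K₂ R)
    (he : ∀ n, (e n).1.length • (e n).1.dir = Φ (latticeVec n)) :
    IsLengthThreshold σ₁ σ₂ K₁ K₂ R := by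
  refine ⟨hΦ.pos, fun T _ => ?_⟩
  obtain ⟨M, hM⟩ := hΦ.exists_bound
  have hfin : {n : {n : Fin d → ℤ | R < ‖Φ (latticeVec n)‖} | ‖latticeVec n.1‖ ≤ T + M}.Finite :=
    (finite_norm_latticeVec_le (T + M)).preimage Subtype.val_injective.injOn
  refine (hfin.image fun n => (e n).1).subset fun γ hγ => ?_
  refine ⟨e.symm ⟨γ, hγ.1⟩, ?_, by simp⟩
  have h1 := he (e.symm ⟨γ, hγ.1⟩)
  rw [e.apply_symm_apply] at h1
  have h2 := hM (latticeVec (e.symm ⟨γ, hγ.1⟩).1)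
  rw [← h1] at h2
  have h3 := norm_sub_norm_le (latticeVec (e.symm ⟨γ, hγ.1⟩).1) (γ.length • γ.dir)
  rw [norm_sub_rev, γ.norm_length_smul_dir] at h3
  have h4 : γ.length ≤ T := hγ.2
  simp only [mem_ofPred_eq]
  linarith

/-- The character `n ↦ e^{2πi b·n}`. -/
noncomputable def latticeCharacter (b : Fin d → ℝ) (n : Fin d → ℤ) : ℂ :=
  Complex.exp (Complex.I * ((∑ i, b i * latticeVec n i : ℝ) : ℂ))

theorem latticeCharacter_add (b : Fin d → ℝ) (n m : Fin d → ℤ) :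
    latticeCharacter b (n + m) = latticeCharacter b n * latticeCharacter b m := by
  simp only [latticeCharacter, latticeVec_add, PiLp.add_apply, mul_add, Finset.sum_add_distrib,
    Complex.ofReal_add, Complex.exp_add]

theorem norm_latticeCharacter (b : Fin d → ℝ) (n : Fin d → ℤ) : ‖latticeCharacter b n‖ = 1 := by
  rw [latticeCharacter, mul_comm, Complex.norm_exp_ofReal_mul_I]

theorem latticeCharacter_intCast (k : Fin d → ℤ) (n : Fin d → ℤ) :
    latticeCharacter (fun i => (k i : ℝ)) n = 1 := by
  rw [latticeCharacter, Complex.exp_eq_one_iff]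
  refine ⟨∑ i, k i * n i, ?_⟩
  simp only [latticeVec_apply]
  push_cast
  rw [Finset.mul_sum, Finset.sum_mul]
  exact Finset.sum_congr rfl fun i _ => by ring

theorem exists_intCast_of_latticeCharacter_single {b : Fin d → ℝ} {i : Fin d}
    (h : latticeCharacter b (Pi.single i 1) = 1) : ∃ k : ℤ, b i = k := by
  rw [latticeCharacter, Complex.exp_eq_one_iff] at h
  obtain ⟨k, hk⟩ := h
  refine ⟨k, ?_⟩
  have h1 : ∑ j, b j * latticeVec (Pi.single i 1) j = 2 * Real.pi * b i := by
    rw [Finset.sum_eq_single i]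
    · simp [mul_comm]
    · intro j _ hj
      simp [hj]
    · simp
  rw [h1] at hk
  have h2 : Complex.I * (2 * Real.pi) ≠ 0 := by simp [Real.pi_ne_zero]
  have h3 : (b i : ℂ) = k := by
    apply mul_left_cancel₀ h2
    push_cast at hk
    linear_combination hk
  exact_mod_cast h3

/-- The homogeneous part of the phase of an orthogeodesic. -/
noncomputable def phaseFactor (b : Fin d → ℝ) (f : FlatTorus d → ℝ) (Y₁ Y₂ : Euc d → Euc d)
    (x : Euc d) : ℂ :=
  Complex.exp (Complex.I * ((f (torusProj (Y₂ x)) - f (torusProj (Y₁ x)) -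
    ∑ i, b i * (Y₁ x - Y₂ x) i : ℝ) : ℂ))

theorem isSmoothHomogeneous_phaseFactor (b : Fin d → ℝ) {f : FlatTorus d → ℝ}
    (hf : ContDiff ℝ ∞ (fun x : Euc d => f (torusProj x))) {Y₁ Y₂ : Euc d → Euc d}
    (hY₁ : IsSmoothHomogeneous Y₁) (hY₂ : IsSmoothHomogeneous Y₂) :
    IsSmoothHomogeneous (phaseFactor b f Y₁ Y₂) := by
  refine ⟨fun x hx => ?_, fun r x hr => ?_⟩
  · have h1 := hY₁.contDiffAt x hx
    have h2 := hY₂.contDiffAt x hx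
    have h3 : ContDiff ℝ ∞ fun y : Euc d => ∑ i, b i * y i :=
      ContDiff.sum fun i _ => by fun_prop
    have h4 : ContDiffAt ℝ ∞ (fun x => f (torusProj (Y₂ x)) - f (torusProj (Y₁ x)) -
        ∑ i, b i * (Y₁ x - Y₂ x) i) x :=
      ((hf.contDiffAt.comp x h2).sub (hf.contDiffAt.comp x h1)).sub
        (h3.contDiffAt.comp x (h1.sub h2))
    exact (contDiffAt_const.mul (Complex.ofRealCLM.contDiff.contDiffAt.comp x h4)).cexp
  · simp only [phaseFactor, hY₁.map_smul r x hr, hY₂.map_smul r x hr]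

/-- The integral of `β` is `b·x + f(Y₂ x) - f(Y₁ x)`, and `x = 2πn - V(x)` separates the character
from a phase homogeneous in `x`. -/
theorem epsteinTerm_eq {β : TorusOneForm d} (hβ : IsSmoothClosed β) {b : Fin d → ℝ}
    {f : FlatTorus d → ℝ} (hf : ContDiff ℝ ∞ (fun x : Euc d => f (torusProj x)))
    (hb : ∀ x v : Euc d, β (torusProj x) v =
      ∑ i, b i * v i + fderiv ℝ (fun x : Euc d => f (torusProj x)) x v)
    {R : ℝ} {Y₁ Y₂ Φ : Euc d → Euc d} (hΦ : IsInverseOutside R (fun x => Y₁ x - Y₂ x) Φ)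
    {γ : GeodesicArc d} {n : Fin d → ℤ} (hn : R < ‖Φ (latticeVec n)‖)
    (hγ : γ.length • γ.dir = Φ (latticeVec n))
    (hs : γ.start = torusProj (Y₁ (Φ (latticeVec n)))) (s : ℂ) :
    epsteinTerm β s γ =
      latticeCharacter b n * symbolTerm R Φ (phaseFactor b f Y₁ Y₂) s (latticeVec n) := by
  have hlen : γ.length = ‖Φ (latticeVec n)‖ := by rw [← hγ, γ.norm_length_smul_dir]
  set x := Φ (latticeVec n) with hx
  have hxn : x + (Y₁ x - Y₂ x) = latticeVec n := (hΦ.eq_iff x _ hn).2 rfl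
  have hproj : torusProj (Y₁ x + x) = torusProj (Y₂ x) := by
    rw [torusProj_eq_iff]
    exact ⟨n, by rw [← hxn]; abel⟩
  have hint := GeodesicArc.integral_eq hβ hf hb hs
  rw [hγ, hproj] at hint
  have hsum : ∑ i, b i * x i = ∑ i, b i * latticeVec n i - ∑ i, b i * (Y₁ x - Y₂ x) i := by
    rw [← Finset.sum_sub_distrib]
    refine Finset.sum_congr rfl fun i _ => ?_
    rw [← hxn, PiLp.add_apply]
    ring
  rw [hsum] at hint
  have hpos : 0 < ‖x‖ := hΦ.pos.trans hn
  rw [epsteinTerm, symbolTerm, if_pos hn, hlen, hint, exp_neg_mul_log_eq_cpow hpos,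
    Complex.cpow_neg, div_eq_mul_inv, latticeCharacter, phaseFactor, ← mul_assoc, ← Complex.exp_add]
  congr 2
  push_cast
  ring

end Orthogeodesics

/-! ### Continuation of the zeta function -/

section Zeta

variable {d : ℕ} {K₁ K₂ : Set (Euc d)}

theorem differentiable_epsteinTerm (β : TorusOneForm d) (γ : GeodesicArc d) :
    Differentiable ℂ fun s => epsteinTerm β s γ := by
  have h0 : (γ.length : ℂ) ≠ 0 := Complex.ofReal_ne_zero.2 γ.length_pos.ne'
  intro s
  refine (differentiableAt_const _).div (DifferentiableAt.const_cpow differentiableAt_id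
    (Or.inl h0)) ?_
  simp [Complex.cpow_eq_zero_iff, h0]

theorem hasSum_subtype_of_finite_sdiff {α : Type*} {S S' : Set α} {f : α → ℂ} {a : ℂ}
    (h₁ : (S' \ S).Finite) (h₂ : (S \ S').Finite) (h : HasSum (fun x : S => f x) a) :
    HasSum (fun x : S' => f x) (a + (∑ x ∈ h₁.toFinset, f x - ∑ x ∈ h₂.toFinset, f x)) := by
  have hi : HasSum (S.indicator f) a := hasSum_subtype_iff_indicator.1 h
  have hf : ∀ {T : Set α} (hT : T.Finite), HasSum (T.indicator f) (∑ x ∈ hT.toFinset, f x) := by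
    intro T hT
    have h3 : ∑ x ∈ hT.toFinset, f x = ∑ x ∈ hT.toFinset, T.indicator f x :=
      Finset.sum_congr rfl fun x hx => (indicator_of_mem (hT.mem_toFinset.1 hx) f).symm
    rw [h3]
    exact hasSum_sum_of_ne_finset_zero fun x hx =>
      indicator_of_notMem (fun hx' => hx (hT.mem_toFinset.2 hx')) f
  refine hasSum_subtype_iff_indicator.2 ((hi.add ((hf h₁).sub (hf h₂))).congr_fun fun x => ?_)
  by_cases hx : x ∈ S <;> by_cases hx' : x ∈ S' <;> simp [hx, hx', indicator]

/-- Changing the length threshold changes the zeta function by an entire function. -/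
theorem exists_differentiable_of_isLengthThreshold {σ₁ σ₂ : ℤˣ} (β : TorusOneForm d) {R T₀ : ℝ}
    (hR : IsLengthThreshold σ₁ σ₂ K₁ K₂ R) (hT : IsLengthThreshold σ₁ σ₂ K₁ K₂ T₀) :
    ∃ h : ℂ → ℂ, Differentiable ℂ h ∧ ∀ F : ℂ → ℂ, ExtendsEpsteinZeta σ₁ σ₂ K₁ K₂ β R F →
      ExtendsEpsteinZeta σ₁ σ₂ K₁ K₂ β T₀ fun s => F s + h s := by
  -- An arc counted for one threshold only has length between the two, so finitely many entire terms
  -- change.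
  have h₁ : (longOrthogeodesics σ₁ σ₂ K₁ K₂ T₀ \ longOrthogeodesics σ₁ σ₂ K₁ K₂ R).Finite :=
    (hT.2 R hR.1).subset fun γ hγ => ⟨hγ.1, not_lt.1 fun h => hγ.2 ⟨hγ.1.1, h⟩⟩
  have h₂ : (longOrthogeodesics σ₁ σ₂ K₁ K₂ R \ longOrthogeodesics σ₁ σ₂ K₁ K₂ T₀).Finite :=
    (hR.2 T₀ hT.1).subset fun γ hγ => ⟨hγ.1, not_lt.1 fun h => hγ.2 ⟨hγ.1.1, h⟩⟩
  refine ⟨fun s => ∑ γ ∈ h₁.toFinset, epsteinTerm β s γ - ∑ γ ∈ h₂.toFinset, epsteinTerm β s γ,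
    ?_, fun F hF s hs => hasSum_subtype_of_finite_sdiff h₁ h₂ (hF s hs)⟩
  exact (Differentiable.fun_sum fun γ _ => differentiable_epsteinTerm β γ).sub
    (Differentiable.fun_sum fun γ _ => differentiable_epsteinTerm β γ)

theorem meromorphicOrderAt_sum_ge {ι : Type*} (S : Finset ι) {u : ι → ℂ → ℂ} {x : ℂ}
    (hu : ∀ i ∈ S, MeromorphicAt (u i) x ∧ -1 ≤ meromorphicOrderAt (u i) x) :
    MeromorphicAt (fun s => ∑ i ∈ S, u i s) x ∧
      -1 ≤ meromorphicOrderAt (fun s => ∑ i ∈ S, u i s) x := by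
  classical
  induction S using Finset.induction_on with
  | empty =>
    have h : AnalyticAt ℂ (fun _ : ℂ => (0 : ℂ)) x := analyticAt_const
    simp only [Finset.sum_empty]
    exact ⟨h.meromorphicAt, le_trans (by decide) h.meromorphicOrderAt_nonneg⟩
  | insert i S hi ih =>
    have h1 := hu i (Finset.mem_insert_self i S)
    have h2 := ih fun j hj => hu j (Finset.mem_insert_of_mem hj)
    have h3 : (fun s => ∑ j ∈ insert i S, u j s) = u i + fun s => ∑ j ∈ S, u j s := by
      funext s
      simp [Finset.sum_insert hi]
    rw [h3]
    exact ⟨h1.1.add h2.1, (le_min h1.2 h2.2).trans (meromorphicOrderAt_add h1.1 h2.1)⟩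

/-- A finite sum of simple fractions has at most simple poles. -/
theorem meromorphicOrderAt_add_sum_div_ge {ι : Type*} (S : Finset ι) {g : ℂ → ℂ} {u : ι → ℂ → ℂ}
    {p : ι → ℂ} (hg : Differentiable ℂ g) (hu : ∀ i, Differentiable ℂ (u i)) (x : ℂ) :
    MeromorphicAt (fun s => g s + ∑ i ∈ S, u i s / (s - p i)) x ∧
      -1 ≤ meromorphicOrderAt (fun s => g s + ∑ i ∈ S, u i s / (s - p i)) x := by
  have hga : AnalyticAt ℂ g x := hg.analyticAt x
  have h1 : -1 ≤ meromorphicOrderAt g x := le_trans (by decide) hga.meromorphicOrderAt_nonneg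
  have h2 := meromorphicOrderAt_sum_ge S (u := fun i s => u i s / (s - p i)) (x := x) fun i _ => by
    have hui : AnalyticAt ℂ (u i) x := (hu i).analyticAt x
    have hpi : AnalyticAt ℂ (fun s => s - p i) x := by fun_prop
    refine ⟨hui.meromorphicAt.div hpi.meromorphicAt, ?_⟩
    have hle : meromorphicOrderAt (fun s => s - p i) x ≤ 1 := by
      rcases eq_or_ne x (p i) with rfl | hne
      · refine le_of_eq ?_
        have := (meromorphicOrderAt_eq_int_iff (n := 1) hpi.meromorphicAt).2
          ⟨fun _ => 1, analyticAt_const, one_ne_zero, by simp⟩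
        exact_mod_cast this
      · rw [hpi.meromorphicOrderAt_eq, (hpi.analyticOrderAt_eq_zero).2 (sub_ne_zero.2 hne)]
        decide
    have h3 : (fun s => u i s / (s - p i)) = u i * (fun s => s - p i)⁻¹ := by
      funext s; simp [div_eq_mul_inv]
    rw [h3, meromorphicOrderAt_mul hui.meromorphicAt hpi.meromorphicAt.inv, meromorphicOrderAt_inv]
    have h4 := hui.meromorphicOrderAt_nonneg
    have h5 : -1 ≤ -meromorphicOrderAt (fun s => s - p i) x := by
      revert hle
      generalize meromorphicOrderAt (fun s => s - p i) x = o
      intro hle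
      cases o with
      | top => exact absurd hle (by decide)
      | coe o =>
        have h6 : o ≤ 1 := by exact_mod_cast hle
        have h7 : (-1 : ℤ) ≤ -o := by omega
        exact WithTop.coe_le_coe.2 h7
    calc (-1 : WithTop ℤ) = 0 + -1 := by simp
      _ ≤ _ := add_le_add h4 h5
  exact ⟨hga.meromorphicAt.add h2.1,
    (le_min h1 h2.2).trans (meromorphicOrderAt_add hga.meromorphicAt h2.1)⟩

/-- The zeta function as a sum over the lattice. -/
theorem extendsEpsteinZeta_of_hasSum {σ₁ σ₂ : ℤˣ} {β : TorusOneForm d} {R : ℝ}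
    {Φ : Euc d → Euc d} {G : Euc d → ℂ} {b : Fin d → ℝ}
    (e : {n : Fin d → ℤ | R < ‖Φ (latticeVec n)‖} ≃ longOrthogeodesics σ₁ σ₂ K₁ K₂ R)
    (he : ∀ n s, epsteinTerm β s (e n).1 =
      latticeCharacter b n * symbolTerm R Φ G s (latticeVec n)) {F : ℂ → ℂ}
    (hF : ∀ s : ℂ, d < s.re →
      HasSum (fun n => latticeCharacter b n * symbolTerm R Φ G s (latticeVec n)) (F s)) :
    ExtendsEpsteinZeta σ₁ σ₂ K₁ K₂ β R F := by
  intro s hs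
  rw [← e.hasSum_iff]
  have h1 : (fun γ : longOrthogeodesics σ₁ σ₂ K₁ K₂ R => epsteinTerm β s γ.1) ∘ e =
      (fun n => latticeCharacter b n * symbolTerm R Φ G s (latticeVec n)) ∘
        ((↑) : {n : Fin d → ℤ | R < ‖Φ (latticeVec n)‖} → Fin d → ℤ) := funext fun n => he n s
  rw [h1, hasSum_subtype_iff_of_support_subset]
  · exact hF s hs
  · intro n hn
    by_contra hcon
    refine hn ?_
    simp only [symbolTerm]
    rw [if_neg (show ¬ R < ‖Φ (latticeVec n)‖ from hcon), mul_zero]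

end Zeta

theorem theorem1p2 (d : ℕ) (hd : 2 ≤ d) (K₁ K₂ : Set (Euc d))
    (hK₁ : IsStrictlyConvexSmooth K₁) (hK₂ : IsStrictlyConvexSmooth K₂) (σ₁ σ₂ : ℤˣ)
    (β : TorusOneForm d) (hβ : IsSmoothClosed β) :
    (∃ T₀ : ℝ, IsLengthThreshold σ₁ σ₂ K₁ K₂ T₀) ∧
    ∀ T₀ : ℝ, IsLengthThreshold σ₁ σ₂ K₁ K₂ T₀ →
      (HasIntegralClass β →
        ∃ F : ℂ → ℂ, ExtendsEpsteinZeta σ₁ σ₂ K₁ K₂ β T₀ F ∧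
          (∀ s : ℂ, (∀ k ∈ Finset.Icc 1 d, s ≠ (k : ℂ)) → AnalyticAt ℂ F s) ∧
          (∀ k ∈ Finset.Icc 1 d,
            MeromorphicAt F (k : ℂ) ∧ -1 ≤ meromorphicOrderAt F (k : ℂ))) ∧
      (¬ HasIntegralClass β →
        ∃ F : ℂ → ℂ, ExtendsEpsteinZeta σ₁ σ₂ K₁ K₂ β T₀ F ∧ Differentiable ℂ F) := by
  have : NeZero d := ⟨by omega⟩
  have : Nontrivial (Euc d) := inferInstance
  obtain ⟨Y₁, hY₁h, hY₁⟩ := hK₁.exists_orientedGaussInverse σ₁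
  obtain ⟨Y₂, hY₂h, hY₂⟩ := hK₂.exists_orientedGaussInverse σ₂
  have hV : IsSmoothHomogeneous fun x => Y₁ x - Y₂ x :=
    ⟨fun x hx => (hY₁h.contDiffAt x hx).sub (hY₂h.contDiffAt x hx), fun r x hr => by
      rw [hY₁h.map_smul r x hr, hY₂h.map_smul r x hr]⟩
  obtain ⟨R, Φ, hΦ, hest⟩ := exists_isInverseOutside hV
  obtain ⟨e, he⟩ := exists_equiv_longOrthogeodesics hY₁h hY₂h hY₁ hY₂ hΦ
  have hthr : IsLengthThreshold σ₁ σ₂ K₁ K₂ R :=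
    isLengthThreshold_of_isInverseOutside hΦ e fun n => (he n).1
  refine ⟨⟨R, hthr⟩, fun T₀ hT₀ => ?_⟩
  obtain ⟨h, hh, hext⟩ := exists_differentiable_of_isLengthThreshold β hthr hT₀
  constructor
  · rintro ⟨k, f, hf, hb⟩
    have hG := isSmoothHomogeneous_phaseFactor (fun i => (k i : ℝ)) hf hY₁h hY₂h
    have hF := isSymbolFamily_symbolTerm hΦ hG (hest _ hG)
    obtain ⟨g, c, hg, hsum⟩ := hF.exists_entire_sub_integral
    obtain ⟨c', hc'⟩ := exists_integral_symbolTerm hV hΦ hG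
    have hRc : (R : ℂ) ≠ 0 := Complex.ofReal_ne_zero.2 hΦ.pos.ne'
    -- The numerator of the fraction at `s = d - k`; with `k < d` these points are exactly `1, …,
    -- d`.
    set u : ℕ → ℂ → ℂ := fun k s => c * c' k * (R : ℂ) ^ ((d : ℂ) - (s + k)) with hu
    have hud : ∀ k, Differentiable ℂ (u k) := fun k s =>
      (DifferentiableAt.const_cpow (by fun_prop) (Or.inl hRc)).const_mul _
    set F : ℂ → ℂ := fun s => (g s + h s) + ∑ k ∈ Finset.range d, u k s / (s - ((d : ℂ) - k)) with hFdef
    have hzeta : ExtendsEpsteinZeta σ₁ σ₂ K₁ K₂ β T₀ F := by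
      have h1 := hext (fun s => g s + ∑ k ∈ Finset.range d, u k s / (s - ((d : ℂ) - k)))
        (extendsEpsteinZeta_of_hasSum e (fun n s =>
          epsteinTerm_eq hβ hf hb hΦ n.2 (he n).1 (he n).2 s) fun s hs => by
            have h2 := hsum s hs
            rw [hc' s hs] at h2
            simp only [latticeCharacter_intCast, one_mul]
            convert h2 using 2
            rw [Finset.mul_sum]
            refine Finset.sum_congr rfl fun k _ => ?_
            simp only [hu]
            rw [sub_sub_eq_add_sub]
            ring)
      intro s hs
      have h3 := h1 s hs
      simp only at h3
      rwa [show g s + ∑ k ∈ Finset.range d, u k s / (s - ((d : ℂ) - k)) + h s = F s by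
        simp only [hFdef]; ring] at h3
    refine ⟨F, hzeta, fun s hs => ?_, fun j _ =>
      meromorphicOrderAt_add_sum_div_ge _ (hg.add hh) hud _⟩
    refine ((hg.add hh).analyticAt s).add (Finset.analyticAt_fun_sum _ fun k hk => ?_)
    refine ((hud k).analyticAt s).div (by fun_prop) (sub_ne_zero.2 ?_)
    have hk' := Finset.mem_range.1 hk
    have h4 := hs (d - k) (Finset.mem_Icc.2 ⟨by omega, by omega⟩)
    rwa [Nat.cast_sub hk'.le] at h4
  · intro hni
    obtain ⟨b, f, hf, hb⟩ := hβ.exists_hasCohomologyClass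
    have hG := isSmoothHomogeneous_phaseFactor b hf hY₁h hY₂h
    have hF := isSymbolFamily_symbolTerm hΦ hG (hest _ hG)
    -- The value at the `i`-th basis vector is `e^{2πi b_i}`; if all were 1, every `b_i` would be an
    -- integer and the class integral.
    have hex : ∃ i, latticeCharacter b (Pi.single i 1) ≠ 1 := by
      by_contra hcon
      push Not at hcon
      choose k hk using fun i => exists_intCast_of_latticeCharacter_single (hcon i)
      refine hni ⟨k, ?_⟩
      rw [show (fun i => (k i : ℝ)) = b from funext fun i => (hk i).symm]
      exact ⟨f, hf, hb⟩
    obtain ⟨i, hi⟩ := hex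
    obtain ⟨g, hg, hsum⟩ := hF.exists_entire_of_character_ne_one (latticeCharacter_add b)
      (norm_latticeCharacter b) hi
    exact ⟨fun s => g s + h s, hext g (extendsEpsteinZeta_of_hasSum e (fun n s =>
      epsteinTerm_eq hβ hf hb hΦ n.2 (he n).1 (he n).2 s) hsum), hg.add hh⟩
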